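/- **Setting.** A *kite* is the quadrilateral $K$ obtained by uniting a nondegenerate triangle $ABP$ with its mirror image $ABP'$ in the side $AB$; its angles at $A$ and $B$ are denoted by $\alpha$ and $\beta$ (in radians), and we assume $\alpha,\beta<\pi$, so that $K$ is convex. Let $\mathbb S^1=\mathbb R/2\pi\mathbb Z$. A finite sequence $x_1,\dots,x_m\in\mathbb S^1$ is *$\alpha\beta$-connected* if each difference $x_{i+1}-x_i$ is one of $\pm\alpha,\pm\beta$. A finite set $S\subset\mathbb S^1$ is a *relative $\epsilon$-net* if it lies in a segment $\Delta\subset\mathbb S^1$ of length in $(0,2\pi)$ such that, after rescaling $\Delta$ linearly to $[0,1]$, each point of $[0,1]$ is within distance $\epsilon$ of $S$. For $\epsilon\in(0,1)$, $F_{\alpha\beta}(\epsilon)$ is the smallest positive integer $n$ such that each $\alpha\beta$-connected sequence with more than $n$ distinct points has a set of points that is a relative $\epsilon$-net; the net-function $F_{\alpha\beta}$ *exists* if there is such an $n$ for every $\epsilon\in(0,1)$. For an integer $k\ge1$ put $$N_{\alpha\beta}(k)=\min\Bigl\{\Bigl\langle \frac{n\alpha+m\beta}{2\pi}\Bigr\rangle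 : n,m\in\mathbb Z,\ (n,m)\neq(0,0),\ |n|+|m|\le k\Bigr\},$$ where $\langle x\rangle$ is the distance from $x$ to the closest integer. A *parallel beam* $B(\epsilon,M)$ in $K$ is a set of parallel segments in the plane that start on a segment (the base) of a side of $K$ and end on a segment (the end) of a side of the last kite in a sequence of copies of $K$, each of which is the reflection of the preceding one in one of its sides; the segments strictly between the two extreme ones cross the successive sides between these copies and meet no vertex. Here $\epsilon>0$ is the width of the beam, that is, the distance between the two extreme parallel lines, and $M$ is the length of its longest segment. The beam *contains a periodic billiard trajectory* if some periodic billiard trajectory in $K$, followed over one full period and unfolded along the same copies of $K$, is a straight segment that lies in the beam as a subset of the plane (its direction may differ from that of the beam). **Theorem 2.** Let $K$ be a kite of diameter $1$ with angles $\alpha,\beta<\pi$ such that $\alpha,\beta,\pi$ are linearly independent over $\mathbb Q$ and the net-function $F_{\alpha\beta}$ exists. For $\epsilon>0$ put $$P_{\alpha\beta}(\epsilon)=F_{\alpha\beta}\Bigl(\bigl(\tfrac{\epsilon}{1600}\bigr)^{[16/\epsilon]+1}\Bigr),\qquad Q_{\alpha\beta}(\epsilon)=\bigl([16/\epsilon]+1\bigr)P_{\alpha\beta}(\epsilon).$$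 Then there is a constant $C>0$, depending only on the kite, such that every parallel beam $B(\epsilon,M)$ in $K$ either contains a periodic billiard trajectory, or satisfies $$M\le Q_{\alpha\beta}(\epsilon)+\frac{C}{\epsilon\,N_{\alpha\beta}(Q_{\alpha\beta}(\epsilon))}.$$ -/

import Mathlib

open scoped EuclideanGeometry

namespace KiteBilliard

noncomputable section

/-! ### Nets and connected sequences on the circle; the functions `F`, `N`, `P`, `Q`

The unit circle is `Real.Angle = ℝ / 2πℤ`; angles are measured in radians. -/

/-- `S` is a relative `ε`-net: it lies in a segment `Δ = {a + ℓ t : t ∈ [0,1]}` of the circle,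
of length `0 < ℓ < 2π`, and, once `Δ` is rescaled linearly to `[0,1]`, every point of `[0,1]` is
at distance at most `ε` from a point of `S`. -/
def IsRelativeNet (ε : ℝ) (S : Finset Real.Angle) : Prop :=
  ∃ a ℓ : ℝ, 0 < ℓ ∧ ℓ < 2 * Real.pi ∧
    (∀ x ∈ S, ∃ t ∈ Set.Icc (0 : ℝ) 1, x = ((a + ℓ * t : ℝ) : Real.Angle)) ∧
    ∀ t ∈ Set.Icc (0 : ℝ) 1, ∃ s ∈ Set.Icc (0 : ℝ) 1,
      ((a + ℓ * s : ℝ) : Real.Angle) ∈ S ∧ |t - s| ≤ ε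

/-- The finite sequence `x 0, …, x (n - 1)` of points of the circle is `αβ`-connected: any two
consecutive terms differ by `±α` or by `±β`. -/
def IsConnectedSeq (α β : ℝ) (n : ℕ) (x : ℕ → Real.Angle) : Prop :=
  ∀ i, i + 1 < n →
    x (i + 1) - x i = (α : Real.Angle) ∨ x (i + 1) - x i = -(α : Real.Angle) ∨
    x (i + 1) - x i = (β : Real.Angle) ∨ x (i + 1) - x i = -(β : Real.Angle)

open Classical in
/-- The set of positive integers `n` such that every `αβ`-connected sequence with more than `n`
distinct points contains a relative `ε`-net. -/
def netNumbers (α β ε : ℝ) : Set ℕ :=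
  {n | 0 < n ∧ ∀ (m : ℕ) (x : ℕ → Real.Angle), IsConnectedSeq α β m x →
    n < ((Finset.range m).image x).card →
    ∃ S ⊆ (Finset.range m).image x, IsRelativeNet ε S}

/-- The net-function `F_{αβ}` exists: the minimum that defines `F_{αβ}(ε)` is over a nonempty set
for all `ε ∈ (0,1)`. -/
def NetFunctionExists (α β : ℝ) : Prop :=
  ∀ ε ∈ Set.Ioo (0 : ℝ) 1, (netNumbers α β ε).Nonempty

/-- The net-function `F_{αβ}(ε)`, the least element of `netNumbers α β ε`. -/
def netF (α β ε : ℝ) : ℕ := sInf (netNumbers α β ε)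

/-- `⟨x⟩`, the distance from `x` to the closest integer. -/
def distInt (x : ℝ) : ℝ := |x - round x|

/-- `N_{αβ}(k)`: the minimum of `⟨(nα + mβ) / 2π⟩` over all pairs of integers
`(n, m) ≠ (0, 0)` with `|n| + |m| ≤ k` (the angles `α`, `β` are in radians, so that
division by `2π` turns them into fractions of a full turn). For `k ≥ 1` this is the infimum of a
finite nonempty set. -/
def smallN (α β : ℝ) (k : ℕ) : ℝ :=
  sInf {d | ∃ n m : ℤ, (n, m) ≠ (0, 0) ∧ |n| + |m| ≤ (k : ℤ) ∧
    d = distInt ((n * α + m * β) / (2 * Real.pi))}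

/-- `P_{αβ}(ε) = F_{αβ}((ε/1600)^{[16/ε]+1})`. -/
def boundP (α β ε : ℝ) : ℕ := netF α β ((ε / 1600) ^ (⌊16 / ε⌋₊ + 1))

/-- `Q_{αβ}(ε) = ([16/ε]+1) P_{αβ}(ε)`. -/
def boundQ (α β ε : ℝ) : ℕ := (⌊16 / ε⌋₊ + 1) * boundP α β ε

/-! ### Kites -/

/-- A kite is given by a nondegenerate triangle `A B P`, which is reflected in its side `AB`. -/
structure Kite where
  A : ℂ
  B : ℂ
  P : ℂ
  nondegenerate : AffineIndependent ℝ ![A, B, P]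

namespace Kite

variable (K : Kite)

/-- The mirror image of `P` in the main diagonal `AB`. -/
def P' : ℂ := EuclideanGeometry.reflection line[ℝ, K.A, K.B] K.P

/-- The vertices in cyclic order `A, P, B, P'`. Side number `j` joins `vertex j` and
`vertex (j + 1)`, with `3 + 1 = 0`. -/
def vertex : Fin 4 → ℂ := ![K.A, K.P, K.B, K.P']

/-- The kite as a set: the union of the triangle and its mirror image. -/
def region : Set ℂ := convexHull ℝ {K.A, K.B, K.P} ∪ convexHull ℝ {K.A, K.B, K.P'}

/-- The (interior) angle of the kite at `A`. -/
def angleA : ℝ := 2 * ∠ K.B K.A K.P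

/-- The (interior) angle of the kite at `B`. -/
def angleB : ℝ := 2 * ∠ K.A K.B K.P

/-- The open side number `j` (without its endpoints). -/
def openSide (j : Fin 4) : Set ℂ := openSegment ℝ (K.vertex j) (K.vertex (j + 1))

/-- The line through two points, as a mirror. -/
def mirror (p q : ℂ) : ℂ ≃ᵃⁱ[ℝ] ℂ := EuclideanGeometry.reflection line[ℝ, p, q]

/-- The Katok–Zemlyakov construction along a sequence `c 0, c 1, c 2, …` of sides: `unfold c i` is
the isometry that carries the kite to its `i`-th copy. The copy number `0` is the kite itself,
and the copy number `i + 1` is the reflection of the copy number `i` in its side `c (i + 1)`.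
(The side `c 0` is the one through which the trajectories enter the copy number `0`.) Labels of
vertices and sides are carried along. -/
def unfold (c : ℕ → Fin 4) : ℕ → (ℂ ≃ᵃⁱ[ℝ] ℂ)
  | 0 => AffineIsometryEquiv.refl ℝ ℂ
  | i + 1 => (unfold c i).trans
      (mirror (unfold c i (K.vertex (c (i + 1)))) (unfold c i (K.vertex (c (i + 1) + 1))))

end Kite

/-! ### Periodic billiard trajectories in a kite -/

/-- A periodic billiard trajectory in a (convex) kite: `point 0, point 1, …` are the successive
reflection points, `side k` is the side that contains `point k`, no vertex is hit, and at each
reflection point the angle of incidence equals the angle of reflection, that is, the incoming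
direction, reflected in the side, is the outgoing direction. -/
structure PeriodicTrajectory (K : Kite) where
  point : ℕ → ℂ
  side : ℕ → Fin 4
  period : ℕ
  period_pos : 0 < period
  mem_side : ∀ k, point k ∈ K.openSide (side k)
  side_ne : ∀ k, side k ≠ side (k + 1)
  reflection_law : ∀ k,
    SameRay ℝ
      (point (k + 1) -
        Kite.mirror (K.vertex (side (k + 1))) (K.vertex (side (k + 1) + 1)) (point k))
      (point (k + 2) - point (k + 1))
  periodic : ∀ k, point (k + period) = point k

/-! ### Parallel beams -/

/-- A parallel beam of trajectories in the kite, unfolded into the plane. All its segments have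
the direction `u`; they start on the base, which is the segment with endpoints `a`, `b` on the
side `side 0` of the kite, and stop on the end, which is the segment with endpoints
`a + lenA • u`, `b + lenB • u` on the side `side n` of the last copy of the kite. Every segment
strictly between the two extreme ones crosses, in this order and away from the
vertices, the sides `side 0, side 1, …, side n` of the successive copies of the kite. -/
structure Beam (K : Kite) where
  n : ℕ
  side : ℕ → Fin 4
  u : ℂ
  a : ℂ
  b : ℂ
  lenA : ℝ
  lenB : ℝ
  n_pos : 0 < n
  norm_u : ‖u‖ = 1
  side_ne : ∀ i < n, side i ≠ side (i + 1)
  nondegenerate : (starRingEnd ℂ u * (b - a)).im ≠ 0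
  crossing : ∀ t ∈ Set.Ioo (0 : ℝ) 1, ∃ r : ℕ → ℝ,
    r 0 = 0 ∧ r n = (1 - t) * lenA + t * lenB ∧
    (∀ i < n, r i < r (i + 1)) ∧
    ∀ i ≤ n, AffineMap.lineMap a b t + r i • u ∈ K.unfold side i '' K.openSide (side i)

namespace Beam

variable {K : Kite} (B : Beam K)

/-- The width of the beam: the distance between the two parallel extreme lines, which pass
through `a` and `b` in the direction `u`. -/
def width : ℝ := |(starRingEnd ℂ B.u * (B.b - B.a)).im|

/-- The length of the longest of the parallel segments of the beam. -/
def length : ℝ := max B.lenA B.lenB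

/-- The beam as a subset of the plane: the union of the segments that lie strictly between the
two extreme ones. -/
def carrier : Set ℂ :=
  {z | ∃ t ∈ Set.Ioo (0 : ℝ) 1, ∃ r ∈ Set.Icc (0 : ℝ) ((1 - t) * B.lenA + t * B.lenB),
    z = AffineMap.lineMap B.a B.b t + r • B.u}

/-- The beam contains, as a set, a periodic billiard trajectory: there is a periodic billiard
trajectory which, when it is unfolded along the copies number `i, …, i + period` of the kite,
stays inside the beam for a full period. (Its direction may differ from that of the beam.) -/
def ContainsPeriodicTrajectory : Prop :=
  ∃ (γ : PeriodicTrajectory K) (i : ℕ), i + γ.period ≤ B.n ∧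
    (∀ k ≤ γ.period, γ.side k = B.side (i + k)) ∧
    ∀ k < γ.period,
      segment ℝ (K.unfold B.side (i + k) (γ.point k))
        (K.unfold B.side (i + k) (γ.point (k + 1))) ⊆ B.carrier

end Beam

end

end KiteBilliard

open KiteBilliard

/-! Let the beam be longer than the bound, and consider the copies number 0 to Q of the kite along
it. Reflecting a copy in a side turns it, up to a fixed reflection, by ±α or ±β, so the angles of
the copies form an αβ-connected sequence. Colour a copy by its parity, the label of the side through
which the beam enters, and a point of a grid of step ε/2 on that side that lies in the middle half
of the beam (`exists_grid_point`). There are at most 16/ε colours.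

If two copies have the same colour and the same angle, they differ by a translation. The segment
joining the two images of the grid point stays in the convex beam, crosses the sides that the beam
crosses, and folds to a periodic trajectory (`containsPeriodicTrajectory_of_translation`).

Otherwise each angle occurs at most once per colour, so there are more than P angles and they
contain a very fine relative net (`exists_eq_color_or_net`). Giving up one power of ε/1600 per
colour leaves a net of mesh ε/1600 in an arc of length l, all of one colour (`exists_dense_color`,
`exists_monochromatic`). Seen in one kite, the corresponding parts of the beam start at the same
point in a fan of directions. Neighbouring ones are so close that, for a length R = 20/l, one stays
inside the other and hits the same sides (`side_eq_side_of_near`). Hence all of them hit the same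
side of the same copy at distance about R, although the extreme ones are more than 1, the diameter,
apart: a contradiction (`false_of_fan`). The fan needs a beam of length about Q + R, and R is at
most a multiple of 1/N because l is at least the gap between two distinct angles
(`smallN_le_of_coe_eq`). -/

namespace KiteBilliard
-- Reflections of the plane in complex notation.
namespace Kite

open ComplexConjugate

/-- In the coordinate w = (z - p)/(q - p) the real part of w runs along the line and the imaginary
part across it, so the reflection conjugates w. -/
theorem mirror_apply {p q : ℂ} (h : p ≠ q) (z : ℂ) :
    mirror p q z = p + (q - p) / conj (q - p) * conj (z - p) := by
  have hd : q - p ≠ 0 := sub_ne_zero.2 h.symm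
  have hd' : conj (q - p) ≠ 0 := (map_ne_zero _).2 hd
  set d := q - p with hdd
  set w := (z - p) / d with hw
  have hzw : z - p = w * d := by rw [hw, div_mul_cancel₀ _ hd]
  have hmem : AffineMap.lineMap p q w.re ∈ line[ℝ, p, q] :=
    AffineMap.lineMap_mem_affineSpan_pair _ _ _
  have hline : (AffineMap.lineMap p q w.re : ℂ) = p + w.re * d := by
    simp [AffineMap.lineMap_apply, hdd]; ring
  have horth : (w.im * Complex.I * d) ∈ line[ℝ, p, q].directionᗮ := by
    rw [direction_affineSpan, vectorSpan_pair_rev, Submodule.mem_orthogonal_singleton_iff_inner_right,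
      Complex.inner]
    simp [← hdd]
    ring
  have hz : z = (w.im * Complex.I * d) +ᵥ (AffineMap.lineMap p q w.re : ℂ) := by
    rw [hline, vadd_eq_add]
    calc z = p + w * d := by rw [← hzw]; ring
      _ = p + (w.re + w.im * Complex.I) * d := by rw [Complex.re_add_im]
      _ = _ := by ring
  have key := EuclideanGeometry.reflection_orthogonal_vadd hmem horth
  rw [← hz] at key
  unfold mirror
  rw [key, hzw, map_mul, hline, vadd_eq_add]
  have : conj w = w.re - w.im * Complex.I := by
    apply Complex.ext <;> simp
  rw [this]
  field_simp
  ring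

theorem apply_mirror (f : ℂ ≃ᵃⁱ[ℝ] ℂ) (p q z : ℂ) :
    f (mirror p q z) = mirror (f p) (f q) (f z) := by
  obtain ⟨b, hb⟩ : ∃ b : ℂ, b = (EuclideanGeometry.orthogonalProjection line[ℝ, p, q] z :
    line[ℝ, p, q]) := ⟨_, rfl⟩
  have hbmem : b ∈ line[ℝ, p, q] :=
    hb ▸ EuclideanGeometry.orthogonalProjection_mem z
  have hv : z -ᵥ b ∈ line[ℝ, p, q].directionᗮ :=
    hb ▸ EuclideanGeometry.vsub_orthogonalProjection_mem_direction_orthogonal _ z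
  have h1 := EuclideanGeometry.reflection_orthogonal_vadd hbmem hv
  rw [vsub_vadd] at h1
  have hfb : f b ∈ line[ℝ, f p, f q] := by
    obtain ⟨r, hr⟩ := mem_affineSpan_pair_iff_exists_lineMap_eq.1 hbmem
    rw [← hr]
    refine mem_affineSpan_pair_iff_exists_lineMap_eq.2 ⟨r, ?_⟩
    exact (AffineMap.apply_lineMap (f.toAffineEquiv : ℂ →ᵃ[ℝ] ℂ) p q r).symm
  have hfv : f.linearIsometryEquiv (z -ᵥ b) ∈ line[ℝ, f p, f q].directionᗮ := by
    rw [direction_affineSpan, vectorSpan_pair_rev,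
      Submodule.mem_orthogonal_singleton_iff_inner_right] at hv ⊢
    rw [← AffineIsometryEquiv.map_vsub, LinearIsometryEquiv.inner_map_map]
    exact hv
  have h2 := EuclideanGeometry.reflection_orthogonal_vadd hfb hfv
  rw [← AffineIsometryEquiv.map_vadd, vsub_vadd] at h2
  unfold mirror
  rw [h1, h2, AffineIsometryEquiv.map_vadd, map_neg]

variable (K : Kite)

/-- Reflecting a copy in its own side amounts to reflecting the original kite in that side and then
unfolding. Inductions can therefore use the mirrors of the original kite only. -/
theorem unfold_succ_apply (c : ℕ → Fin 4) (i : ℕ) (z : ℂ) :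
    K.unfold c (i + 1) z
      = K.unfold c i (mirror (K.vertex (c (i + 1))) (K.vertex (c (i + 1) + 1)) z) := by
  rw [apply_mirror]
  rfl

end Kite
end KiteBilliard

/-! ### The shape of a convex kite. -/

namespace KiteBilliard
namespace Kite

open ComplexConjugate

variable (K : Kite)

theorem A_ne_B : K.A ≠ K.B := fun h => by
  have := K.nondegenerate.injective.ne (show (0 : Fin 3) ≠ 1 by decide)
  exact this h

theorem P'_eq : K.P' = K.A + (K.B - K.A) / conj (K.B - K.A) * conj (K.P - K.A) :=
  mirror_apply K.A_ne_B K.P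

theorem P_sub_A_ne_zero : K.P - K.A ≠ 0 := fun h =>
  K.nondegenerate.injective.ne (show (2 : Fin 3) ≠ 0 by decide) (sub_eq_zero.1 h)

theorem P_sub_B_ne_zero : K.P - K.B ≠ 0 := fun h =>
  K.nondegenerate.injective.ne (show (2 : Fin 3) ≠ 1 by decide) (sub_eq_zero.1 h)

theorem B_sub_A_ne_zero : K.B - K.A ≠ 0 := sub_ne_zero.2 K.A_ne_B.symm

/-- In the complex coordinate in which `A` and `B` are `0` and `1`, the other two vertices of a
convex kite are `x ± y i` with `0 < x < 1`. -/
theorem exists_coord (hα : K.angleA < Real.pi) (hβ : K.angleB < Real.pi) :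
    ∃ x y : ℝ, 0 < x ∧ x < 1 ∧ y ≠ 0 ∧
      K.P = K.A + (x + y * Complex.I) * (K.B - K.A) ∧
      K.P' = K.A + (x - y * Complex.I) * (K.B - K.A) := by
  have hBA := K.B_sub_A_ne_zero
  have hPA := K.P_sub_A_ne_zero
  have hPB := K.P_sub_B_ne_zero
  have hBA' : conj (K.B - K.A) ≠ 0 := (map_ne_zero _).2 hBA
  set w := (K.P - K.A) / (K.B - K.A) with hw
  have hPw : K.P - K.A = w * (K.B - K.A) := by rw [hw, div_mul_cancel₀ _ hBA]
  have hw0 : w ≠ 0 := div_ne_zero hPA hBA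
  refine ⟨w.re, w.im, ?_, ?_, ?_, ?_, ?_⟩
  -- Half the angle at A is acute, which says that 1/w, and hence w, has positive real part. The
  -- angle at B gives the same for 1 - w.
  · have h : |((K.B - K.A) / (K.P - K.A)).arg| < Real.pi / 2 := by
      have : K.angleA = 2 * |((K.B - K.A) / (K.P - K.A)).arg| := by
        unfold angleA EuclideanGeometry.angle
        rw [vsub_eq_sub, vsub_eq_sub, Complex.angle_eq_abs_arg hBA hPA]
      linarith
    rw [Complex.abs_arg_lt_pi_div_two_iff] at h
    have e : (K.B - K.A) / (K.P - K.A) = w⁻¹ := by rw [hw, inv_div]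
    rw [e] at h
    rcases h with h | h
    · rw [Complex.inv_re] at h
      exact (div_pos_iff_of_pos_right (Complex.normSq_pos.2 hw0)).1 h
    · exact absurd h (inv_ne_zero hw0)
  · have hAB : K.A - K.B ≠ 0 := sub_ne_zero.2 K.A_ne_B
    have h : |((K.A - K.B) / (K.P - K.B)).arg| < Real.pi / 2 := by
      have : K.angleB = 2 * |((K.A - K.B) / (K.P - K.B)).arg| := by
        unfold angleB EuclideanGeometry.angle
        rw [vsub_eq_sub, vsub_eq_sub, Complex.angle_eq_abs_arg hAB hPB]
      linarith
    rw [Complex.abs_arg_lt_pi_div_two_iff] at h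
    have e0 : K.P - K.B = (1 - w) * (K.A - K.B) := by linear_combination hPw
    have hw1 : 1 - w ≠ 0 := fun h0 => hPB (by rw [e0, h0, zero_mul])
    have e : (K.A - K.B) / (K.P - K.B) = (1 - w)⁻¹ := by
      rw [e0]; field_simp
    rw [e] at h
    rcases h with h | h
    · rw [Complex.inv_re] at h
      have := (div_pos_iff_of_pos_right (Complex.normSq_pos.2 hw1)).1 h
      simp at this
      exact this
    · exact absurd h (inv_ne_zero hw1)
  · intro h0
    have hnc := affineIndependent_iff_not_collinear_set.1 K.nondegenerate
    apply hnc
    rw [collinear_iff_of_mem (p₀ := K.A) (by simp)]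
    refine ⟨K.B - K.A, ?_⟩
    intro p hp
    simp only [Set.mem_insert_iff, Set.mem_singleton_iff] at hp
    rcases hp with rfl | rfl | rfl
    · exact ⟨0, by simp⟩
    · exact ⟨1, by simp⟩
    · refine ⟨w.re, ?_⟩
      have : (w.re : ℂ) = w := Complex.ext (by simp) (by simp [h0])
      rw [vadd_eq_add, Complex.real_smul, this, ← hPw]; ring
  · rw [Complex.re_add_im, ← hPw]; ring
  · have : conj w = w.re - w.im * Complex.I := by
      apply Complex.ext <;> simp
    rw [K.P'_eq, hPw, ← this, map_mul]
    field_simp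

/-- A convex kite lies on one side of each of its side lines. -/
theorem exists_side_form (hα : K.angleA < Real.pi) (hβ : K.angleB < Real.pi) (c : Fin 4) :
    ∃ (m : ℂ) (k : ℝ), (m * K.vertex c).re + k = 0 ∧ (m * K.vertex (c + 1)).re + k = 0 ∧
      0 < (m * K.vertex (c + 2)).re + k ∧ 0 < (m * K.vertex (c + 3)).re + k := by
  obtain ⟨x, y, hx0, hx1, hy, hP, hP'⟩ := K.exists_coord hα hβ
  have hBA := K.B_sub_A_ne_zero
  obtain ⟨ζ, hζ⟩ : ∃ ζ : Fin 4 → ℂ, ζ = ![0, x + y * Complex.I, 1, x - y * Complex.I] := ⟨_, rfl⟩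
  have hv : ∀ j, K.vertex j = K.A + ζ j * (K.B - K.A) := by
    intro j
    fin_cases j <;> simp [vertex, hζ, hP, hP']
  have hy2 : 0 < y ^ 2 := by positivity
  -- Multiplication by i turns the conjugated edge into a normal form; the factor y makes the normal
  -- point inwards for either orientation of the kite.
  refine ⟨y * Complex.I * conj (ζ (c + 1) - ζ c) / (K.B - K.A),
    -(y * Complex.I * conj (ζ (c + 1) - ζ c) / (K.B - K.A) * K.vertex c).re, ?_⟩
  have key : ∀ j, (y * Complex.I * conj (ζ (c + 1) - ζ c) / (K.B - K.A) * K.vertex j).re +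
      -(y * Complex.I * conj (ζ (c + 1) - ζ c) / (K.B - K.A) * K.vertex c).re =
      (y * Complex.I * conj (ζ (c + 1) - ζ c) * (ζ j - ζ c)).re := by
    intro j
    rw [← Complex.neg_re, ← Complex.add_re, hv, hv]
    congr 1
    field_simp
    ring
  simp only [key]
  subst hζ
  fin_cases c
  all_goals simp
  · refine ⟨by ring, by nlinarith, by nlinarith⟩
  · refine ⟨by ring, by nlinarith, by nlinarith⟩
  · refine ⟨by ring, by nlinarith, by nlinarith⟩
  · refine ⟨by ring, by nlinarith, by nlinarith⟩

/-- The number v / conj v has twice the argument of v. The sides make angles ±α/2 or ±β/2 with the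
axis AB, so relative to the axis, whose own number is D, these quotients are exponentials of ±α or
±β. -/
theorem exists_rotation (α β : ℝ) (hA : K.angleA = α) (hB : K.angleB = β) :
    ∃ (D : ℂ) (a : Fin 4 → ℝ), D * conj D = 1 ∧
      (∀ c, a c = α ∨ a c = -α ∨ a c = β ∨ a c = -β) ∧
      ∀ c, (K.vertex (c + 1) - K.vertex c) / conj (K.vertex (c + 1) - K.vertex c) =
        D * Complex.exp (a c * Complex.I) := by
  have hBA := K.B_sub_A_ne_zero
  have hPA := K.P_sub_A_ne_zero
  have hPB := K.P_sub_B_ne_zero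
  have hAB : K.A - K.B ≠ 0 := sub_ne_zero.2 K.A_ne_B
  have hBA' : conj (K.B - K.A) ≠ 0 := (map_ne_zero _).2 hBA
  have polar : ∀ z : ℂ, z ≠ 0 → conj z / z = Complex.exp ((-(2 * z.arg) : ℝ) * Complex.I) := by
    intro z hz
    have h1 := Complex.norm_mul_exp_arg_mul_I z
    have h2 : conj z = ‖z‖ * Complex.exp (-(z.arg * Complex.I)) := by
      conv_lhs => rw [← h1]
      rw [map_mul, ← Complex.exp_conj]
      simp
    rw [div_eq_iff hz, h2]
    calc (‖z‖ : ℂ) * Complex.exp (-(z.arg * Complex.I))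
        = Complex.exp ((-(2 * z.arg) : ℝ) * Complex.I) *
          (‖z‖ * Complex.exp (z.arg * Complex.I)) := by
          rw [mul_left_comm, ← Complex.exp_add]
          congr 2
          push_cast; ring
      _ = _ := by rw [h1]
  obtain ⟨z, hz⟩ : ∃ z, z = (K.B - K.A) / (K.P - K.A) := ⟨_, rfl⟩
  obtain ⟨z', hz'⟩ : ∃ z, z = (K.A - K.B) / (K.P - K.B) := ⟨_, rfl⟩
  have pz := polar z (hz ▸ div_ne_zero hBA hPA)
  have pz' := polar z' (hz' ▸ div_ne_zero hAB hPB)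
  have sgn : ∀ a b : ℝ, 2 * |a| = b → (2 * a = b ∨ 2 * a = -b) := by
    intro a b h
    rcases abs_cases a with ⟨h1, _⟩ | ⟨h1, _⟩
    · left; linarith
    · right; linarith
  have hα : 2 * z.arg = α ∨ 2 * z.arg = -α := by
    apply sgn
    rw [← hA, hz]
    unfold angleA EuclideanGeometry.angle
    rw [vsub_eq_sub, vsub_eq_sub, Complex.angle_eq_abs_arg hBA hPA]
  have hβ : 2 * z'.arg = β ∨ 2 * z'.arg = -β := by
    apply sgn
    rw [← hB, hz']
    unfold angleB EuclideanGeometry.angle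
    rw [vsub_eq_sub, vsub_eq_sub, Complex.angle_eq_abs_arg hAB hPB]
  have inv1 : ∀ t : ℝ, Complex.exp ((t : ℝ) * Complex.I) =
      (Complex.exp ((-t : ℝ) * Complex.I))⁻¹ := by
    intro t
    rw [← Complex.exp_neg]
    congr 1
    push_cast; ring
  have hPA' : conj (K.P - K.A) ≠ 0 := (map_ne_zero _).2 hPA
  have hPB' : conj (K.P - K.B) ≠ 0 := (map_ne_zero _).2 hPB
  have hP'A : K.P' - K.A = (K.B - K.A) / conj (K.B - K.A) * conj (K.P - K.A) := by
    rw [K.P'_eq]; ring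
  have hP'B : K.P' - K.B = (K.B - K.A) / conj (K.B - K.A) * conj (K.P - K.B) := by
    have : conj (K.P - K.A) = conj (K.P - K.B) + conj (K.B - K.A) := by
      rw [← map_add]; congr 1; ring
    rw [K.P'_eq, this]; field_simp; ring
  refine ⟨(K.B - K.A) / conj (K.B - K.A),
    ![-(2 * z.arg), -(2 * z'.arg), 2 * z'.arg, 2 * z.arg], ?_, ?_, ?_⟩
  · rw [map_div₀, Complex.conj_conj]; field_simp
  · intro c
    fin_cases c <;> simp <;> grind
  · have e1 : conj z / z = conj (K.B - K.A) / (K.B - K.A) * ((K.P - K.A) / conj (K.P - K.A)) := by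
      rw [hz, map_div₀]; field_simp
    have e2 : conj z' / z' = conj (K.B - K.A) / (K.B - K.A) * ((K.P - K.B) / conj (K.P - K.B)) := by
      rw [hz', ← neg_sub K.B K.A, map_div₀, map_neg]; field_simp
    intro c
    fin_cases c
    · change (K.P - K.A) / conj (K.P - K.A) = _ * Complex.exp ((-(2 * z.arg) : ℝ) * _)
      rw [← pz, e1]; field_simp
    · change (K.B - K.P) / conj (K.B - K.P) = _ * Complex.exp ((-(2 * z'.arg) : ℝ) * _)
      rw [← pz', e2, ← neg_sub K.P K.B, map_neg]; field_simp
    · change (K.P' - K.B) / conj (K.P' - K.B) = _ * Complex.exp ((2 * z'.arg : ℝ) * _)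
      rw [inv1, ← pz', e2, hP'B, map_mul, map_div₀, Complex.conj_conj, Complex.conj_conj]
      field_simp
    · change (K.A - K.P') / conj (K.A - K.P') = _ * Complex.exp ((2 * z.arg : ℝ) * _)
      rw [inv1, ← pz, e1, ← neg_sub K.P' K.A, map_neg, hP'A, map_mul, map_div₀,
        Complex.conj_conj, Complex.conj_conj]
      field_simp

end Kite
end KiteBilliard

/-! ### How the unfolded copies are turned, and how lines cross a kite. -/

namespace KiteBilliard
namespace Kite

open ComplexConjugate

/-- The angle by which the `i`-th copy of the kite is turned, when the reflection in side `c`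
turns it by `± a c`. -/
noncomputable def turn (a : Fin 4 → ℝ) (c : ℕ → Fin 4) : ℕ → ℝ
  | 0 => 0
  | i + 1 => turn a c i + (-1) ^ i * a (c (i + 1))

variable {K : Kite}

theorem vertex_ne (hα : K.angleA < Real.pi) (hβ : K.angleB < Real.pi) (c : Fin 4) :
    K.vertex c ≠ K.vertex (c + 1) := by
  intro h
  have e0 : c + 1 + 3 = c := by
    fin_cases c <;> rfl
  obtain ⟨m, k, h0, -, -, h3⟩ := K.exists_side_form hα hβ (c + 1)
  rw [e0, h] at h3
  linarith

/-- Linear parts of successive mirrors multiply. Each mirror contributes a conjugation, which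
inverts the next rotation factor; this is the alternating sign in `turn`. The factors D cancel in
pairs. -/
theorem unfold_sub_unfold (hv : ∀ c, K.vertex c ≠ K.vertex (c + 1)) {D : ℂ} {a : Fin 4 → ℝ}
    (hD : D * conj D = 1)
    (ha : ∀ c, (K.vertex (c + 1) - K.vertex c) / conj (K.vertex (c + 1) - K.vertex c) =
        D * Complex.exp (a c * Complex.I)) (c : ℕ → Fin 4) (i : ℕ) (z z' : ℂ) :
    K.unfold c i z - K.unfold c i z' =
      Complex.exp (turn a c i * Complex.I) * (if Even i then z - z' else D * conj (z - z')) := by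
  induction i generalizing z z' with
  | zero => simp [turn, unfold]
  | succ i ih =>
    rw [unfold_succ_apply, unfold_succ_apply, ih, mirror_apply (hv _), mirror_apply (hv _), ha]
    have hconj : conj (Complex.exp (a (c (i + 1)) * Complex.I)) =
        Complex.exp (-(a (c (i + 1)) * Complex.I)) := by
      rw [← Complex.exp_conj]; simp
    by_cases hi : Even i
    · have hi' : ¬ Even (i + 1) := by simpa [Nat.even_add_one] using hi
      rw [if_pos hi, if_neg hi', turn, hi.neg_one_pow]
      push_cast
      rw [one_mul, add_mul, Complex.exp_add, map_sub, map_sub, map_sub]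
      ring
    · have hi' : Even (i + 1) := by simpa [Nat.even_add_one] using hi
      rw [if_neg hi, if_pos hi', turn, (Nat.not_even_iff_odd.1 hi).neg_one_pow]
      push_cast
      rw [neg_one_mul, add_mul, neg_mul, Complex.exp_add]
      simp only [map_sub, map_add, map_mul, Complex.conj_conj, hconj]
      linear_combination (Complex.exp (turn a c i * Complex.I) *
        Complex.exp (-(a (c (i + 1)) * Complex.I)) * (z - z')) * hD

/-- The reflection z ↦ D conj z is present in both copies or in neither, so only a rotation remains.
This is why the colour of a copy records its parity. -/
theorem unfold_sub_unfold_of_parity (hv : ∀ c, K.vertex c ≠ K.vertex (c + 1)) {D : ℂ}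
    {a : Fin 4 → ℝ} (hD : D * conj D = 1)
    (ha : ∀ c, (K.vertex (c + 1) - K.vertex c) / conj (K.vertex (c + 1) - K.vertex c) =
        D * Complex.exp (a c * Complex.I)) (c : ℕ → Fin 4) {i j : ℕ} (hij : Even i ↔ Even j)
    (z z' : ℂ) :
    K.unfold c j z - K.unfold c j z' =
      Complex.exp ((turn a c j - turn a c i : ℝ) * Complex.I) *
        (K.unfold c i z - K.unfold c i z') := by
  rw [unfold_sub_unfold hv hD ha, unfold_sub_unfold hv hD ha, ← mul_assoc, ← Complex.exp_add]
  simp only [hij]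
  congr 2
  push_cast; ring

theorem unfold_add (c : ℕ → Fin 4) (i k : ℕ) (z : ℂ) :
    K.unfold c (i + k) z = K.unfold c i (K.unfold (fun l => c (i + l)) k z) := by
  induction k generalizing z with
  | zero => rfl
  | succ k ih => rw [← add_assoc, unfold_succ_apply, ih, unfold_succ_apply, add_assoc]

theorem unfold_congr {c c' : ℕ → Fin 4} {k : ℕ} (h : ∀ l ≤ k, c l = c' l) :
    K.unfold c k = K.unfold c' k := by
  induction k with
  | zero => rfl
  | succ k ih =>
    rw [unfold, unfold, ih fun l hl => h l (by omega), h (k + 1) le_rfl]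

theorem mirror_eq_of_mem_openSide {c : Fin 4} {z : ℂ} (hz : z ∈ K.openSide c) :
    mirror (K.vertex c) (K.vertex (c + 1)) z = z := by
  rw [mirror, EuclideanGeometry.reflection_eq_self_iff]
  rw [openSide, openSegment_eq_image_lineMap] at hz
  obtain ⟨t, -, rfl⟩ := hz
  exact AffineMap.lineMap_mem_affineSpan_pair _ _ _

theorem unfold_succ_of_mem_openSide {c : ℕ → Fin 4} {i : ℕ} {z : ℂ}
    (hz : z ∈ K.openSide (c (i + 1))) : K.unfold c (i + 1) z = K.unfold c i z := by
  rw [unfold_succ_apply, mirror_eq_of_mem_openSide hz]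

theorem unfold_succ_image_openSide (c : ℕ → Fin 4) (i : ℕ) :
    K.unfold c (i + 1) '' K.openSide (c (i + 1)) = K.unfold c i '' K.openSide (c (i + 1)) :=
  Set.image_congr fun _ hz => unfold_succ_of_mem_openSide hz

theorem exists_side_form_openSide (hα : K.angleA < Real.pi) (hβ : K.angleB < Real.pi)
    (c : Fin 4) :
    ∃ (m : ℂ) (k : ℝ), (∀ z ∈ K.openSide c, (m * z).re + k = 0) ∧
      ∀ c', c' ≠ c → ∀ z ∈ K.openSide c', 0 < (m * z).re + k := by
  obtain ⟨m, k, h0, h1, h2, h3⟩ := K.exists_side_form hα hβ c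
  have conv : ∀ (p q : ℂ) (s t : ℝ), s + t = 1 → (m * (s • p + t • q)).re + k =
      s * ((m * p).re + k) + t * ((m * q).re + k) := by
    intro p q s t hst
    have : k = s * k + t * k := by rw [← add_mul, hst, one_mul]
    simp only [Complex.real_smul, Complex.mul_re, Complex.add_re, Complex.add_im,
      Complex.mul_im, Complex.ofReal_re, Complex.ofReal_im]
    linear_combination this
  refine ⟨m, k, ?_, ?_⟩
  · rintro z ⟨s, t, hs, ht, hst, rfl⟩
    rw [conv _ _ _ _ hst, h0, h1]; ring
  · rintro c' hc' z ⟨s, t, hs, ht, hst, rfl⟩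
    rw [conv _ _ _ _ hst]
    have hcases : ∀ c c' : Fin 4, c' ≠ c → c' = c + 1 ∨ c' = c + 2 ∨ c' = c + 3 := by decide
    have e1 : ∀ c : Fin 4, c + 1 + 1 = c + 2 := by decide
    have e2 : ∀ c : Fin 4, c + 2 + 1 = c + 3 := by decide
    have e3 : ∀ c : Fin 4, c + 3 + 1 = c := by decide
    rcases hcases c c' hc' with rfl | rfl | rfl
    · rw [e1, h1]; nlinarith
    · rw [e2]; nlinarith
    · rw [e3, h0]; nlinarith

/-- A line meets at most two of the open sides of a convex kite. -/
theorem eq_or_eq_of_line (hα : K.angleA < Real.pi) (hβ : K.angleB < Real.pi)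
    {c₁ c₂ c₃ : Fin 4} {p v : ℂ} {r₁ r₂ r₃ : ℝ} (h₁ : p + r₁ • v ∈ K.openSide c₁)
    (h₂ : p + r₂ • v ∈ K.openSide c₂) (h₃ : p + r₃ • v ∈ K.openSide c₃) (h : c₁ ≠ c₂) :
    c₃ = c₁ ∨ c₃ = c₂ := by
  -- An affine function on a line cannot vanish at a middle point and be positive on both sides of
  -- it; it is applied to the form of the middle side.
  have mid : ∀ {c₁ c₂ c₃ : Fin 4} {r₁ r₂ r₃ : ℝ}, p + r₁ • v ∈ K.openSide c₁ →
      p + r₂ • v ∈ K.openSide c₂ → p + r₃ • v ∈ K.openSide c₃ → c₁ ≠ c₂ → c₃ ≠ c₂ →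
      r₁ ≤ r₂ → r₂ ≤ r₃ → False := by
    intro c₁ c₂ c₃ r₁ r₂ r₃ h₁ h₂ h₃ h12 h32 hr1 hr2
    obtain ⟨m, k, h0, hp⟩ := exists_side_form_openSide hα hβ c₂
    have aff : ∀ r : ℝ, (m * (p + r • v)).re + k = ((m * p).re + k) + r * (m * v).re := by
      intro r
      simp only [Complex.real_smul, Complex.mul_re, Complex.add_re, Complex.add_im,
        Complex.mul_im, Complex.ofReal_re, Complex.ofReal_im]
      ring
    have a2 := h0 _ h₂
    have a1 := hp _ h12 _ h₁
    have a3 := hp _ h32 _ h₃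
    rw [aff] at a1 a2 a3
    rcases le_total 0 (m * v).re with hB | hB
    · nlinarith
    · nlinarith
  by_contra! hne
  obtain ⟨h31, h32⟩ := hne
  rcases le_total r₁ r₂ with h12' | h12'
  · rcases le_total r₂ r₃ with h23' | h23'
    · exact mid h₁ h₂ h₃ h h32 h12' h23'
    · rcases le_total r₁ r₃ with h13' | h13'
      · exact mid h₁ h₃ h₂ h31.symm h32.symm h13' h23'
      · exact mid h₃ h₁ h₂ h31 h.symm h13' h12'
  · rcases le_total r₁ r₃ with h13' | h13'
    · exact mid h₂ h₁ h₃ h.symm h31 h12' h13'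
    · rcases le_total r₂ r₃ with h23' | h23'
      · exact mid h₂ h₃ h₁ h32.symm h31.symm h23' h13'
      · exact mid h₃ h₂ h₁ h32 h h23' h12'

theorem openSide_subset_region (c : Fin 4) : K.openSide c ⊆ K.region := by
  refine (openSegment_subset_segment _ _ _).trans ?_
  fin_cases c
  · refine Set.subset_union_of_subset_left (segment_subset_convexHull ?_ ?_) _ <;> simp [vertex]
  · refine Set.subset_union_of_subset_left (segment_subset_convexHull ?_ ?_) _ <;> simp [vertex]
  · refine Set.subset_union_of_subset_right (segment_subset_convexHull ?_ ?_) _ <;> simp [vertex]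
  · refine Set.subset_union_of_subset_right (segment_subset_convexHull ?_ ?_) _ <;> simp [vertex]

theorem isBounded_region : Bornology.IsBounded K.region := by
  refine Bornology.IsBounded.union ?_ ?_ <;>
  · rw [isBounded_convexHull]
    exact Set.Finite.isBounded (by simp)

theorem dist_le_of_mem_openSide (hd : Metric.diam K.region = 1) {c c' : Fin 4} {z z' : ℂ}
    (hz : z ∈ K.openSide c) (hz' : z' ∈ K.openSide c') : dist z z' ≤ 1 :=
  hd ▸ Metric.dist_le_diam_of_mem isBounded_region (openSide_subset_region c hz)
    (openSide_subset_region c' hz')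

end Kite
end KiteBilliard

/-! ### Coordinates across and along a beam. -/

namespace KiteBilliard
namespace Beam

open ComplexConjugate

variable {K : Kite} (B : Beam K)

open Classical in
/-- The distances, from the base, at which the line number `t` of the beam crosses the
successive sides. -/
noncomputable def time (t : ℝ) : ℕ → ℝ :=
  if h : t ∈ Set.Ioo (0 : ℝ) 1 then (B.crossing t h).choose else 0

variable {B} in
theorem time_spec {t : ℝ} (h : t ∈ Set.Ioo (0 : ℝ) 1) :
    B.time t 0 = 0 ∧ B.time t B.n = (1 - t) * B.lenA + t * B.lenB ∧
    (∀ i < B.n, B.time t i < B.time t (i + 1)) ∧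
    ∀ i ≤ B.n, AffineMap.lineMap B.a B.b t + B.time t i • B.u ∈
      K.unfold B.side i '' K.openSide (B.side i) := by
  unfold time
  rw [dif_pos h]
  exact (B.crossing t h).choose_spec

/-- The displacement `w` measured across the beam, in units of the (signed) width. -/
noncomputable def shift (w : ℂ) : ℝ :=
  (conj B.u * w).im / (conj B.u * (B.b - B.a)).im

/-- The number of the line of the beam through `z`. -/
noncomputable def pos (z : ℂ) : ℝ := B.shift (z - B.a)

theorem conj_u_mul_u : conj B.u * B.u = 1 := by
  rw [mul_comm, Complex.mul_conj, Complex.normSq_eq_norm_sq, B.norm_u]; simp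

theorem width_pos : 0 < B.width := abs_pos.2 B.nondegenerate

theorem shift_add (v w : ℂ) : B.shift (v + w) = B.shift v + B.shift w := by
  unfold shift; rw [mul_add, Complex.add_im, add_div]

theorem shift_smul (r : ℝ) (w : ℂ) : B.shift (r • w) = r * B.shift w := by
  unfold shift
  rw [Complex.real_smul, mul_left_comm, Complex.im_ofReal_mul, mul_div_assoc]

theorem shift_u : B.shift B.u = 0 := by
  unfold shift; rw [conj_u_mul_u]; simp

theorem abs_shift_eq (w : ℂ) : |B.shift w| = |(conj B.u * w).im| / B.width := abs_div _ _

theorem abs_shift_le (w : ℂ) : |B.shift w| ≤ ‖w‖ / B.width := by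
  rw [abs_shift_eq]
  refine div_le_div_of_nonneg_right ?_ B.width_pos.le
  refine (Complex.abs_im_le_norm _).trans ?_
  rw [norm_mul, RCLike.norm_conj, B.norm_u, one_mul]

theorem pos_add (z w : ℂ) : B.pos (z + w) = B.pos z + B.shift w := by
  unfold pos; rw [← shift_add]; congr 1; ring

theorem pos_eq_add (z w : ℂ) : B.pos z = B.pos w + B.shift (z - w) := by
  rw [← pos_add]; congr 1; ring

theorem pos_lineMap (p q : ℂ) (s : ℝ) :
    B.pos (AffineMap.lineMap p q s) = (1 - s) * B.pos p + s * B.pos q := by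
  rw [AffineMap.lineMap_apply, vadd_eq_add, vsub_eq_sub, add_comm, pos_add, shift_smul,
    B.pos_eq_add q p]
  ring

theorem pos_a : B.pos B.a = 0 := by simp [pos, shift]

theorem pos_b : B.pos B.b = 1 := div_self B.nondegenerate

theorem pos_line (t r : ℝ) : B.pos (AffineMap.lineMap B.a B.b t + r • B.u) = t := by
  rw [pos_add, shift_smul, shift_u, pos_lineMap, pos_a, pos_b]; ring

theorem exists_eq_line (z : ℂ) :
    ∃ r : ℝ, z = AffineMap.lineMap B.a B.b (B.pos z) + r • B.u := by
  set w := z - AffineMap.lineMap B.a B.b (B.pos z) with hw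
  have h0 : B.shift w = 0 := by
    have := B.pos_eq_add z (AffineMap.lineMap B.a B.b (B.pos z))
    have h := B.pos_line (B.pos z) 0
    rw [zero_smul, add_zero] at h
    rw [h] at this
    linarith
  have h1 : (conj B.u * w).im = 0 := (div_eq_zero_iff.1 h0).resolve_right B.nondegenerate
  refine ⟨(conj B.u * w).re, ?_⟩
  have h2 : ((conj B.u * w).re : ℂ) = conj B.u * w := Complex.ext (by simp) (by simp [h1])
  rw [Complex.real_smul, h2, mul_right_comm, conj_u_mul_u, one_mul, hw]; ring

variable {B}

theorem exists_pos_param {k : ℕ} (hk : k ≤ B.n) {t : ℝ} (ht : t ∈ Set.Ioo (0 : ℝ) 1) :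
    ∃ s ∈ Set.Ioo (0 : ℝ) 1,
      B.pos (K.unfold B.side k
        (AffineMap.lineMap (K.vertex (B.side k)) (K.vertex (B.side k + 1)) s)) = t := by
  obtain ⟨o, ho, h⟩ := (time_spec ht).2.2.2 k hk
  rw [Kite.openSide, openSegment_eq_image_lineMap] at ho
  obtain ⟨s, hs, rfl⟩ := ho
  exact ⟨s, hs, by rw [h, pos_line]⟩

theorem pos_unfold_lineMap (k : ℕ) (p q : ℂ) (s : ℝ) :
    B.pos (K.unfold B.side k (AffineMap.lineMap p q s)) =
      B.pos (K.unfold B.side k p) +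
        s * B.shift (K.unfold B.side k q - K.unfold B.side k p) := by
  have h := (AffineMap.apply_lineMap ((K.unfold B.side k).toAffineEquiv : ℂ →ᵃ[ℝ] ℂ) p q s)
  have h' : K.unfold B.side k (AffineMap.lineMap p q s) =
    AffineMap.lineMap (K.unfold B.side k p) (K.unfold B.side k q) s := h
  rw [h', pos_lineMap, B.pos_eq_add (K.unfold B.side k q) (K.unfold B.side k p)]
  ring

/-- Along a side the position across the beam is affine, and it is not constant because it takes the
values 1/4 and 3/4. So the side meets each line of the beam only once. -/
theorem eq_line_of_mem {k : ℕ} (hk : k ≤ B.n) {o : ℂ} (ho : o ∈ K.openSide (B.side k))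
    (hp : B.pos (K.unfold B.side k o) ∈ Set.Ioo (0 : ℝ) 1) :
    K.unfold B.side k o = AffineMap.lineMap B.a B.b (B.pos (K.unfold B.side k o)) +
      B.time (B.pos (K.unfold B.side k o)) k • B.u := by
  obtain ⟨o', ho', h⟩ := (time_spec hp).2.2.2 k hk
  rw [← h]
  congr 1
  have hpos : B.pos (K.unfold B.side k o') = B.pos (K.unfold B.side k o) := by
    rw [h, pos_line]
  obtain ⟨s₁, -, h₁⟩ := exists_pos_param hk (t := 1 / 4) (by norm_num)
  obtain ⟨s₂, -, h₂⟩ := exists_pos_param hk (t := 3 / 4) (by norm_num)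
  rw [Kite.openSide, openSegment_eq_image_lineMap] at ho ho'
  obtain ⟨s, hs, rfl⟩ := ho
  obtain ⟨s', hs', rfl⟩ := ho'
  rw [pos_unfold_lineMap] at h₁ h₂
  rw [pos_unfold_lineMap, pos_unfold_lineMap] at hpos
  have hne : B.shift (K.unfold B.side k (K.vertex (B.side k + 1)) -
    K.unfold B.side k (K.vertex (B.side k))) ≠ 0 := by
    intro h0
    rw [h0] at h₁ h₂
    linarith
  rw [mul_right_cancel₀ hne (add_left_cancel hpos)]

theorem norm_smul_u (r : ℝ) : ‖r • B.u‖ = |r| := by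
  rw [norm_smul, B.norm_u, mul_one, Real.norm_eq_abs]

theorem dist_le_of_mem (hd : Metric.diam K.region = 1) {k : ℕ} {z z' : ℂ}
    (hz : z ∈ K.unfold B.side k '' K.openSide (B.side k))
    (hz' : z' ∈ K.unfold B.side k '' K.openSide (B.side k)) : dist z z' ≤ 1 := by
  obtain ⟨o, ho, rfl⟩ := hz
  obtain ⟨o', ho', rfl⟩ := hz'
  rw [AffineIsometryEquiv.dist_map]
  exact Kite.dist_le_of_mem_openSide hd ho ho'

theorem time_succ_le (hd : Metric.diam K.region = 1) {t : ℝ} (ht : t ∈ Set.Ioo (0 : ℝ) 1) {k : ℕ}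
    (hk : k < B.n) : B.time t (k + 1) ≤ B.time t k + 1 := by
  have h1 := (time_spec ht).2.2.2 k hk.le
  have h2 := (time_spec ht).2.2.2 (k + 1) hk
  rw [Kite.unfold_succ_image_openSide] at h2
  obtain ⟨o, ho, h1⟩ := h1
  obtain ⟨o', ho', h2⟩ := h2
  have h := Kite.dist_le_of_mem_openSide hd ho' ho
  rw [← (K.unfold B.side k).dist_map, h1, h2, dist_eq_norm, add_sub_add_left_eq_sub, ← sub_smul,
    norm_smul_u] at h
  linarith [le_abs_self (B.time t (k + 1) - B.time t k)]

theorem time_le (hd : Metric.diam K.region = 1) {t : ℝ} (ht : t ∈ Set.Ioo (0 : ℝ) 1) {k : ℕ}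
    (hk : k ≤ B.n) : B.time t k ≤ k := by
  induction k with
  | zero => rw [(time_spec ht).1]; simp
  | succ k ih =>
    have := time_succ_le hd ht (Nat.lt_of_succ_le hk)
    have := ih (by omega)
    push_cast
    linarith

theorem time_mono {t : ℝ} (ht : t ∈ Set.Ioo (0 : ℝ) 1) {i j : ℕ} (hij : i ≤ j)
    (hj : j ≤ B.n) : B.time t i ≤ B.time t j := by
  induction j, hij using Nat.le_induction with
  | base => exact le_rfl
  | succ j _ ih => exact (ih (by omega)).trans ((time_spec ht).2.2.1 j (by omega)).le

theorem time_strictMono {t : ℝ} (ht : t ∈ Set.Ioo (0 : ℝ) 1) {i j : ℕ} (hij : i < j)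
    (hj : j ≤ B.n) : B.time t i < B.time t j :=
  ((time_spec ht).2.2.1 i (by omega)).trans_le (time_mono ht hij hj)

/-- Only lines strictly inside the beam are known to start on the side. Those numbered 1/4 and 3/4
bound half of the base by the diameter. -/
theorem norm_base_le (hd : Metric.diam K.region = 1) : ‖B.b - B.a‖ ≤ 2 := by
  have h1 := (time_spec (B := B) (t := 1 / 4) (by norm_num))
  have h2 := (time_spec (B := B) (t := 3 / 4) (by norm_num))
  have h := dist_le_of_mem hd (h2.2.2.2 0 (Nat.zero_le _)) (h1.2.2.2 0 (Nat.zero_le _))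
  rw [h1.1, h2.1, zero_smul, add_zero, add_zero, dist_eq_norm] at h
  have e : (AffineMap.lineMap B.a B.b (3 / 4 : ℝ) - AffineMap.lineMap B.a B.b (1 / 4 : ℝ) : ℂ) =
      (1 / 2 : ℝ) • (B.b - B.a) := by
    simp [AffineMap.lineMap_apply]; ring
  rw [e, norm_smul] at h
  norm_num at h
  linarith

theorem width_le (hd : Metric.diam K.region = 1) : B.width ≤ 2 := by
  refine le_trans ?_ (norm_base_le (B := B) hd)
  refine (Complex.abs_im_le_norm _).trans ?_
  rw [norm_mul, RCLike.norm_conj, B.norm_u, one_mul]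

/-- The end is at most 2 long for the same reason as the base; the difference of the two lengths is
a difference of the end and base vectors. -/
theorem abs_lenB_sub_lenA_le (hd : Metric.diam K.region = 1) : |B.lenB - B.lenA| ≤ 4 := by
  have h1 := (time_spec (B := B) (t := 1 / 4) (by norm_num))
  have h2 := (time_spec (B := B) (t := 3 / 4) (by norm_num))
  have h := dist_le_of_mem hd (h2.2.2.2 B.n le_rfl) (h1.2.2.2 B.n le_rfl)
  rw [h1.2.1, h2.2.1, dist_eq_norm] at h
  have e : ((B.lenB - B.lenA) • B.u : ℂ) =
      (2 : ℝ) • (AffineMap.lineMap B.a B.b (3 / 4 : ℝ) +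
        ((1 - 3 / 4 : ℝ) * B.lenA + 3 / 4 * B.lenB) • B.u -
      (AffineMap.lineMap B.a B.b (1 / 4 : ℝ) +
        ((1 - 1 / 4 : ℝ) * B.lenA + 1 / 4 * B.lenB) • B.u)) - (B.b - B.a) := by
    simp [AffineMap.lineMap_apply]; ring
  rw [← norm_smul_u (B := B), e]
  refine (norm_sub_le _ _).trans ?_
  rw [norm_smul, Real.norm_of_nonneg zero_le_two]
  linarith [norm_base_le (B := B) hd]

theorem length_sub_le_time (hd : Metric.diam K.region = 1) {t : ℝ}
    (ht : t ∈ Set.Ioo (0 : ℝ) 1) : B.length - 4 ≤ B.time t B.n := by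
  rw [(time_spec ht).2.1]
  have h := abs_le.1 (abs_lenB_sub_lenA_le (B := B) hd)
  obtain ⟨h0, h1⟩ := ht
  unfold length
  rcases le_total B.lenA B.lenB with hl | hl
  · rw [max_eq_right hl]; nlinarith
  · rw [max_eq_left hl]; nlinarith

/-- Of the points that divide a side of the kite into pieces of relative length `width / 2`, one
lies in the middle half of the beam. -/
theorem exists_grid_point (hd : Metric.diam K.region = 1) {k : ℕ} (hk : k ≤ B.n) :
    ∃ l ∈ Finset.Icc 1 ⌊2 / B.width⌋₊, ∃ o ∈ K.openSide (B.side k),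
      o = AffineMap.lineMap (K.vertex (B.side k)) (K.vertex (B.side k + 1)) (l * (B.width / 2)) ∧
      B.pos (K.unfold B.side k o) ∈ Set.Icc (1 / 4 : ℝ) (3 / 4) := by
  obtain ⟨s₁, hs₁, h₁⟩ := exists_pos_param hk (t := 1 / 4) (by norm_num)
  obtain ⟨s₂, hs₂, h₂⟩ := exists_pos_param hk (t := 3 / 4) (by norm_num)
  obtain ⟨v, hv⟩ : ∃ v, v = K.vertex (B.side k) := ⟨_, rfl⟩
  obtain ⟨v', hv'⟩ : ∃ v', v' = K.vertex (B.side k + 1) := ⟨_, rfl⟩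
  rw [← hv, ← hv', pos_unfold_lineMap] at h₁ h₂
  obtain ⟨q, hq⟩ : ∃ q, q = B.shift (K.unfold B.side k v' - K.unfold B.side k v) := ⟨_, rfl⟩
  obtain ⟨p, hp⟩ : ∃ p, p = B.pos (K.unfold B.side k v) := ⟨_, rfl⟩
  rw [← hq, ← hp] at h₁ h₂
  have hw := B.width_pos
  have hlen : |s₂ - s₁| * ‖v' - v‖ ≤ 1 := by
    have m : ∀ s ∈ Set.Ioo (0 : ℝ) 1, AffineMap.lineMap v v' s ∈ K.openSide (B.side k) := by
      intro s hs
      rw [Kite.openSide, openSegment_eq_image_lineMap, ← hv, ← hv']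
      exact ⟨s, hs, rfl⟩
    have h := Kite.dist_le_of_mem_openSide hd (m s₂ hs₂) (m s₁ hs₁)
    rw [dist_lineMap_lineMap, Real.dist_eq, dist_comm, dist_eq_norm] at h
    exact h
  have hside : ‖v' - v‖ ≤ 1 := by
    have : ∀ c, K.vertex c ∈ K.region := by
      intro c
      fin_cases c
      · exact Or.inl (subset_convexHull _ _ (by simp [Kite.vertex]))
      · exact Or.inl (subset_convexHull _ _ (by simp [Kite.vertex]))
      · exact Or.inl (subset_convexHull _ _ (by simp [Kite.vertex]))
      · exact Or.inr (subset_convexHull _ _ (by simp [Kite.vertex]))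
    rw [← dist_eq_norm, ← hd, hv, hv']
    exact Metric.dist_le_diam_of_mem Kite.isBounded_region (this _) (this _)
  have hq1 : |q| * B.width ≤ 1 := by
    have h := B.abs_shift_le (K.unfold B.side k v' - K.unfold B.side k v)
    rw [← hq, ← dist_eq_norm, AffineIsometryEquiv.dist_map, dist_eq_norm, le_div_iff₀ hw] at h
    linarith
  -- The middle half of the beam cuts from the side a parameter interval at least as long as the
  -- grid step, so some grid point falls in it.
  have hs : B.width / 2 ≤ |s₂ - s₁| := by
    have h : (s₂ - s₁) * q = 1 / 2 := by linarith
    have h' : |s₂ - s₁| * |q| = 1 / 2 := by rw [← abs_mul, h]; norm_num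
    nlinarith [abs_nonneg (s₂ - s₁)]
  obtain ⟨hi, hhi⟩ : ∃ hi, hi = max s₁ s₂ := ⟨_, rfl⟩
  obtain ⟨lo, hlo⟩ : ∃ lo, lo = min s₁ s₂ := ⟨_, rfl⟩
  have hdiff : hi - lo = |s₂ - s₁| := by rw [hhi, hlo, max_sub_min_eq_abs]
  have hlo0 : 0 < lo := by rw [hlo]; exact lt_min hs₁.1 hs₂.1
  have hhi1 : hi < 1 := by rw [hhi]; exact max_lt hs₁.2 hs₂.2
  have hw2 : 0 < B.width / 2 := by linarith
  have f1 := Nat.floor_le (a := hi / (B.width / 2)) (by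
    have : 0 ≤ hi := by linarith [abs_nonneg (s₂ - s₁)]
    positivity)
  have f2 := Nat.lt_floor_add_one (hi / (B.width / 2))
  rw [le_div_iff₀ hw2] at f1
  rw [div_lt_iff₀ hw2] at f2
  -- The last grid point not beyond the upper end of that interval; it is not a vertex because the
  -- lower end is positive and the upper one is below 1.
  obtain ⟨l, hl⟩ : ∃ l, l = ⌊hi / (B.width / 2)⌋₊ := ⟨_, rfl⟩
  rw [← hl] at f1 f2
  have hlb : lo ≤ l * (B.width / 2) := by linarith
  have hl0 : 0 < l := by
    by_contra h0
    have : l = 0 := by omega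
    rw [this] at hlb
    simp at hlb
    linarith
  refine ⟨l, ?_, AffineMap.lineMap v v' (l * (B.width / 2)), ?_, by rw [hv, hv'], ?_⟩
  · rw [Finset.mem_Icc]
    refine ⟨hl0, Nat.le_floor ?_⟩
    rw [le_div_iff₀ hw]
    linarith
  · rw [Kite.openSide, openSegment_eq_image_lineMap, ← hv, ← hv']
    exact ⟨_, ⟨by linarith, by linarith⟩, rfl⟩
  · rw [pos_unfold_lineMap, ← hq, ← hp]
    rcases le_total s₁ s₂ with h | h
    · rw [max_eq_right h] at hhi
      rw [min_eq_left h] at hlo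
      subst hhi hlo
      have : 0 ≤ q := by
        by_contra hq0
        nlinarith
      constructor <;> nlinarith
    · rw [max_eq_left h] at hhi
      rw [min_eq_right h] at hlo
      subst hhi hlo
      have : q ≤ 0 := by
        by_contra hq0
        nlinarith
      constructor <;> nlinarith

end Beam
end KiteBilliard

/-! ### Periodic trajectories from translated copies. -/

namespace KiteBilliard
namespace Beam

open ComplexConjugate

variable {K : Kite} {B : Beam K}

theorem convex_carrier (B : Beam K) : Convex ℝ B.carrier := by
  rintro _ ⟨t, ht, r, hr, rfl⟩ _ ⟨t', ht', r', hr', rfl⟩ s s' hs hs' hss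
  refine ⟨s * t + s' * t', (convex_Ioo (0 : ℝ) 1) ht ht' hs hs' hss, s * r + s' * r', ⟨?_, ?_⟩, ?_⟩
  · have := hr.1
    have := hr'.1
    positivity
  · have e : (1 - (s * t + s' * t')) * B.lenA + (s * t + s' * t') * B.lenB =
        s * ((1 - t) * B.lenA + t * B.lenB) + s' * ((1 - t') * B.lenA + t' * B.lenB) := by
      linear_combination -B.lenA * hss
    rw [e]
    exact add_le_add (mul_le_mul_of_nonneg_left hr.2 hs) (mul_le_mul_of_nonneg_left hr'.2 hs')
  · have hc : (s : ℂ) + s' = 1 := by exact_mod_cast hss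
    simp only [AffineMap.lineMap_apply, vadd_eq_add, vsub_eq_sub, Complex.real_smul]
    push_cast
    linear_combination B.a * hc

theorem mem_carrier_of_mem {k : ℕ} (hk : k ≤ B.n) {o : ℂ} (ho : o ∈ K.openSide (B.side k))
    (hp : B.pos (K.unfold B.side k o) ∈ Set.Ioo (0 : ℝ) 1) : K.unfold B.side k o ∈ B.carrier := by
  refine ⟨_, hp, _, ⟨?_, ?_⟩, eq_line_of_mem hk ho hp⟩
  · rw [← (time_spec hp).1]
    exact time_mono hp (Nat.zero_le k) hk
  · rw [← (time_spec hp).2.1]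
    exact time_mono hp hk le_rfl

/-- Used to extend data on one period to a periodic sequence: agreement of the two ends is what
makes the wrap-around step an ordinary one. -/
theorem apply_mod_succ {X : Type*} {f : ℕ → X} {p : ℕ} (hp : 0 < p) (hf : f p = f 0) (k : ℕ) :
    f ((k + 1) % p) = f (k % p + 1) := by
  have h := Nat.mod_lt k hp
  rw [← Nat.mod_add_mod]
  rcases Nat.lt_or_ge (k % p + 1) p with h' | h'
  · rw [Nat.mod_eq_of_lt h']
  · have e : k % p + 1 = p := by omega
    rw [e, Nat.mod_self, hf]

theorem lineMap_mem_image_openSide (c : ℕ → Fin 4) (k : ℕ) {d : Fin 4} {z z' : ℂ}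
    (hz : z ∈ K.unfold c k '' K.openSide d) (hz' : z' ∈ K.unfold c k '' K.openSide d) {s : ℝ}
    (hs : s ∈ Set.Icc (0 : ℝ) 1) :
    AffineMap.lineMap z z' s ∈ K.unfold c k '' K.openSide d := by
  obtain ⟨o, ho, rfl⟩ := hz
  obtain ⟨o', ho', rfl⟩ := hz'
  exact ⟨AffineMap.lineMap o o' s, (convex_openSegment _ _).lineMap_mem ho ho' hs,
    AffineMap.apply_lineMap ((K.unfold c k).toAffineEquiv : ℂ →ᵃ[ℝ] ℂ) o o' s⟩

/-- If two copies of the kite differ by a translation, and a point of the side through which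
the beam enters the first is carried by it to a point that is still in the beam, then the
trajectory between these two points is periodic. -/
theorem containsPeriodicTrajectory_of_translation {i j : ℕ} (hij : i < j) (hj : j ≤ B.n)
    (hside : B.side j = B.side i) {o : ℂ} (ho : o ∈ K.openSide (B.side i))
    (hpi : B.pos (K.unfold B.side i o) ∈ Set.Ioo (0 : ℝ) 1)
    (hpj : B.pos (K.unfold B.side j o) ∈ Set.Ioo (0 : ℝ) 1)
    (htr : ∀ z z', K.unfold B.side j z - K.unfold B.side j z' =
      K.unfold B.side i z - K.unfold B.side i z') :
    B.ContainsPeriodicTrajectory := by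
  obtain ⟨p, rfl⟩ : ∃ p, j = i + p := ⟨j - i, by omega⟩
  have hp : 0 < p := by omega
  have hx := eq_line_of_mem (by omega) ho hpi
  have hy := eq_line_of_mem hj (hside ▸ ho) hpj
  have hxc := mem_carrier_of_mem (by omega) ho hpi
  have hyc := mem_carrier_of_mem hj (hside ▸ ho) hpj
  obtain ⟨x, hxo⟩ : ∃ x, x = K.unfold B.side i o := ⟨_, rfl⟩
  obtain ⟨y, hyo⟩ : ∃ y, y = K.unfold B.side (i + p) o := ⟨_, rfl⟩
  rw [← hxo] at hpi hx hxc
  rw [← hyo] at hpj hy hyc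
  have htx := time_spec (B := B) hpi
  have hty := time_spec (B := B) hpj
  set P : ℕ → ℝ := fun m => B.time (B.pos x) (i + m) - B.time (B.pos x) i with hP
  set Q : ℕ → ℝ := fun m => B.time (B.pos y) (i + p) - B.time (B.pos y) (i + m) with hQ
  have hP0 : P 0 = 0 := by simp [hP]
  have hQp : Q p = 0 := by simp [hQ]
  have hPm : ∀ m m', m < m' → m' ≤ p → P m < P m' := fun m m' h h' =>
    sub_lt_sub_right (time_strictMono (B := B) hpi (by omega) (by omega)) _
  have hQm : ∀ m m', m < m' → m' ≤ p → Q m' < Q m := fun m m' h h' =>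
    sub_lt_sub_left (time_strictMono (B := B) hpj (by omega) (by omega)) _
  have hPnn : ∀ m ≤ p, 0 ≤ P m := fun m h => sub_nonneg.2 (time_mono (B := B) hpi (by omega) (by omega))
  have hQnn : ∀ m ≤ p, 0 ≤ Q m := fun m h => sub_nonneg.2 (time_mono (B := B) hpj (by omega) (by omega))
  have hPQ : ∀ m ≤ p, 0 < P m + Q m := by
    intro m h
    rcases h.lt_or_eq with h' | rfl
    · have := hPnn m h
      have := hQm m p h' le_rfl
      linarith
    · have := hPm 0 m hp le_rfl
      linarith
  -- Side number i + m contains x + P u and y - Q u, points on the two beam lines through x and y.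
  -- The chord between them meets the segment xy at the fraction P/(P + Q) of both.
  set s : ℕ → ℝ := fun m => P m / (P m + Q m) with hs
  have hs0 : s 0 = 0 := by simp [hs, hP0]
  have hsp : s p = 1 := by
    have := hPQ p le_rfl
    rw [hQp, add_zero] at this
    simp [hs, hQp, this.ne']
  have hsI : ∀ m ≤ p, s m ∈ Set.Icc (0 : ℝ) 1 := fun m h =>
    ⟨div_nonneg (hPnn m h) (hPQ m h).le, (div_le_one (hPQ m h)).2 (by linarith [hQnn m h])⟩
  have hsm : ∀ m, m < p → s m ≤ s (m + 1) := by
    intro m h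
    rw [hs, div_le_div_iff₀ (hPQ m h.le) (hPQ (m + 1) h)]
    have h1 := (hPm m (m + 1) (by omega) h).le
    have h2 := (hQm m (m + 1) (by omega) h).le
    have := mul_le_mul h1 h2 (hQnn _ h) (hPnn (m + 1) h)
    linarith
  set z : ℕ → ℂ := fun m => AffineMap.lineMap x y (s m) with hz
  have hz0 : z 0 = x := by simp [hz, hs0]
  have hzp : z p = y := by simp [hz, hsp]
  have hzE : ∀ m ≤ p, z m ∈ K.unfold B.side (i + m) '' K.openSide (B.side (i + m)) := by
    intro m h
    have e1 := htx.2.2.2 (i + m) (by omega)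
    have e2 := hty.2.2.2 (i + m) (by omega)
    convert lineMap_mem_image_openSide _ _ e1 e2 (hsI m h) using 1
    have e1' : AffineMap.lineMap B.a B.b (B.pos x) + B.time (B.pos x) (i + m) • B.u =
        x + P m • B.u := by
      conv_rhs => rw [hx]
      rw [hP, sub_smul]; ring
    have e2' : AffineMap.lineMap B.a B.b (B.pos y) + B.time (B.pos y) (i + m) • B.u =
        y - Q m • B.u := by
      conv_rhs => rw [hy]
      rw [hQ, sub_smul]; ring
    rw [e1', e2']
    simp only [hz, AffineMap.lineMap_apply, vadd_eq_add, vsub_eq_sub, Complex.real_smul]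
    have e3 : s m * (P m + Q m) = P m := div_mul_cancel₀ _ (hPQ m h).ne'
    have e4 : (s m : ℂ) * (P m + Q m) = P m := by exact_mod_cast e3
    linear_combination B.u * e4
  have hzstep : ∀ m, z (m + 1) - z m = (s (m + 1) - s m) • (y - x) := by
    intro m
    simp only [hz, AffineMap.lineMap_apply, vadd_eq_add, vsub_eq_sub, Complex.real_smul]
    push_cast; ring
  set q : ℕ → ℂ := fun m => (K.unfold B.side (i + m)).symm (z m) with hq
  have hqz : ∀ m, K.unfold B.side (i + m) (q m) = z m := fun m =>
    AffineIsometryEquiv.apply_symm_apply _ _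
  have hqmem : ∀ m ≤ p, q m ∈ K.openSide (B.side (i + m)) := by
    intro m h
    obtain ⟨o', ho', e⟩ := hzE m h
    have : q m = o' := by rw [hq]; simp only; rw [← e, AffineIsometryEquiv.symm_apply_apply]
    rwa [this]
  have hq0 : q 0 = o := by
    simp only [hq, hz0, hxo]
    exact AffineIsometryEquiv.symm_apply_apply _ _
  have hqp : q p = q 0 := by
    rw [hq0]
    simp only [hq, hzp, hyo]
    exact AffineIsometryEquiv.symm_apply_apply _ _
  have hqz' : ∀ m < p, K.unfold B.side (i + m) (q (m + 1)) = z (m + 1) := by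
    intro m h
    rw [← hqz (m + 1)]
    exact (Kite.unfold_succ_of_mem_openSide (hqmem (m + 1) h)).symm
  have lin : ∀ (f : ℂ ≃ᵃⁱ[ℝ] ℂ) (a b : ℂ), f.linearIsometryEquiv (a - b) = f a - f b :=
    fun f a b => f.map_vsub a b
  -- The direction of the segment xy as seen in each copy. Since the two end copies are translates,
  -- it returns to its initial value after one period, which gives the reflection law at the
  -- wrap-around.
  set w : ℕ → ℂ := fun m => (K.unfold B.side (i + m)).linearIsometryEquiv.symm (y - x) with hw
  have hwp : w p = w 0 := by
    simp only [hw]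
    rw [LinearIsometryEquiv.symm_apply_eq]
    have e := htr ((K.unfold B.side (i + 0)).linearIsometryEquiv.symm (y - x)) 0
    rw [← lin, ← lin, sub_zero] at e
    rw [e]
    exact (LinearIsometryEquiv.apply_symm_apply _ _).symm
  have step : ∀ m < p, q (m + 1) - q m = (s (m + 1) - s m) • w m := by
    intro m h
    apply (K.unfold B.side (i + m)).linearIsometryEquiv.injective
    rw [lin, hqz, hqz' m h, hzstep, map_smul]
    simp only [hw, LinearIsometryEquiv.apply_symm_apply]
  have refl : ∀ m < p, q (m + 1) - Kite.mirror (K.vertex (B.side (i + (m + 1))))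
      (K.vertex (B.side (i + (m + 1)) + 1)) (q m) = (s (m + 1) - s m) • w (m + 1) := by
    intro m h
    apply (K.unfold B.side (i + (m + 1))).linearIsometryEquiv.injective
    rw [lin, hqz, ← add_assoc, Kite.unfold_succ_apply, Kite.mirror,
      EuclideanGeometry.reflection_reflection, hqz, hzstep, map_smul]
    simp only [hw, ← add_assoc, LinearIsometryEquiv.apply_symm_apply]
  have hmod : ∀ k, k % p < p := fun k => Nat.mod_lt k hp
  have hqs : ∀ k, q ((k + 1) % p) = q (k % p + 1) := apply_mod_succ hp hqp
  have hws : ∀ k, w ((k + 1) % p) = w (k % p + 1) := apply_mod_succ hp hwp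
  have hcs : ∀ k, B.side (i + (k + 1) % p) = B.side (i + (k % p + 1)) :=
    apply_mod_succ (f := fun m => B.side (i + m)) hp hside
  refine ⟨⟨fun k => q (k % p), fun k => B.side (i + k % p), p, hp,
    fun k => hqmem _ (hmod k).le, ?_, ?_, ?_⟩, i, hj, ?_, ?_⟩
  · intro k
    simp only [hcs]
    exact B.side_ne _ (by have := hmod k; omega)
  · intro k
    rw [hqs (k + 1), hqs k, hcs, refl _ (hmod k), ← hqs k, step _ (hmod (k + 1)), hws]
    exact ((SameRay.refl _).nonneg_smul_left (sub_nonneg.2 (hsm _ (hmod k)))).nonneg_smul_right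
      (sub_nonneg.2 (hsm _ (hmod (k + 1))))
  · intro k
    simp only [Nat.add_mod_right]
  · intro k hk
    rcases Nat.lt_or_ge k p with h | h
    · simp only [Nat.mod_eq_of_lt h]
    · have e : k = p := le_antisymm hk h
      simp only [e, Nat.mod_self]
      exact hside.symm
  · intro k hk
    have hk' : k < p := hk
    simp only [hqs k]
    simp only [Nat.mod_eq_of_lt hk', hqz, hqz' k hk']
    exact B.convex_carrier.segment_subset (B.convex_carrier.lineMap_mem hxc hyc (hsI k hk'.le))
      (B.convex_carrier.lineMap_mem hxc hyc (hsI (k + 1) hk'))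

end Beam
end KiteBilliard

/-! ### Fans of overlapping parts of a beam. -/

namespace KiteBilliard
namespace Beam

open ComplexConjugate

variable {K : Kite} {B : Beam K}

/-- The beam line through the point already crosses two sides of this copy, and a line meets no
third one. -/
theorem eq_side_of_pos_mem (hα : K.angleA < Real.pi) (hβ : K.angleB < Real.pi) {k : ℕ}
    (hk : k < B.n) {d : Fin 4} {z : ℂ} (hz : z ∈ K.openSide d)
    (hp : B.pos (K.unfold B.side k z) ∈ Set.Ioo (0 : ℝ) 1) :
    d = B.side k ∨ d = B.side (k + 1) := by
  obtain ⟨r, hr⟩ := B.exists_eq_line (K.unfold B.side k z)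
  have h1 := (time_spec hp).2.2.2 k hk.le
  have h2 := (time_spec hp).2.2.2 (k + 1) hk
  rw [Kite.unfold_succ_image_openSide] at h2
  obtain ⟨t, ht⟩ : ∃ t, t = B.pos (K.unfold B.side k z) := ⟨_, rfl⟩
  rw [← ht] at h1 h2 hr
  have pull : ∀ (r : ℝ) (y : ℂ),
      K.unfold B.side k y = AffineMap.lineMap B.a B.b t + r • B.u →
      y = (K.unfold B.side k).symm (AffineMap.lineMap B.a B.b t) +
        r • (K.unfold B.side k).symm.linearIsometryEquiv B.u := by
    intro r y h
    apply (K.unfold B.side k).injective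
    rw [h, add_comm (AffineMap.lineMap B.a B.b t), add_comm ((K.unfold B.side k).symm _),
      ← vadd_eq_add, ← vadd_eq_add, ← map_smul, ← AffineIsometryEquiv.map_vadd,
      AffineIsometryEquiv.apply_symm_apply]
  obtain ⟨o₁, ho₁, e₁⟩ := h1
  obtain ⟨o₂, ho₂, e₂⟩ := h2
  rw [pull _ _ e₁] at ho₁
  rw [pull _ _ e₂] at ho₂
  rw [pull _ _ hr] at hz
  exact Kite.eq_or_eq_of_line hα hβ ho₁ ho₂ hz (B.side_ne k hk)

theorem exists_mem_openSide_of_line {i k : ℕ} (hi : i + k ≤ B.n) {o : ℂ}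
    (ho : o ∈ K.openSide (B.side i)) (hp : B.pos (K.unfold B.side i o) ∈ Set.Ioo (0 : ℝ) 1) :
    ∃ o' ∈ K.openSide (B.side (i + k)), K.unfold B.side (i + k) o' = K.unfold B.side i o +
      (B.time (B.pos (K.unfold B.side i o)) (i + k) -
        B.time (B.pos (K.unfold B.side i o)) i) • B.u := by
  have h := eq_line_of_mem (by omega) ho hp
  obtain ⟨o', ho', e⟩ := (time_spec hp).2.2.2 (i + k) hi
  refine ⟨o', ho', ?_⟩
  rw [e]
  conv_rhs => arg 1; rw [h]
  rw [sub_smul]; ring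

theorem shift_exp_mul_u (φ ρ : ℝ) :
    |B.shift (Complex.exp (φ * Complex.I) * ρ • B.u)| = |ρ| * |Real.sin φ| / B.width := by
  rw [abs_shift_eq]
  have e : conj B.u * (Complex.exp (φ * Complex.I) * ρ • B.u) =
      (ρ : ℝ) * Complex.exp (φ * Complex.I) := by
    rw [Complex.real_smul]
    linear_combination (ρ * Complex.exp (φ * Complex.I)) * B.conj_u_mul_u
  rw [e, Complex.im_ofReal_mul, Complex.exp_ofReal_mul_I_im, abs_mul]

/-- The parts of a beam that start at copies number `i` and `j` of the kite, seen in the same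
kite, cross the same sides as long as the first one does not leave the second one sideways. -/
theorem side_eq_side_of_near (hα : K.angleA < Real.pi) (hβ : K.angleB < Real.pi)
    (hd : Metric.diam K.region = 1) {i j : ℕ} (hj : j ≤ B.n) (hside : B.side j = B.side i)
    {φ R : ℝ} (htr : ∀ z z', K.unfold B.side j z - K.unfold B.side j z' =
      Complex.exp (φ * Complex.I) * (K.unfold B.side i z - K.unfold B.side i z'))
    {o : ℂ} (ho : o ∈ K.openSide (B.side i))
    (hpi : B.pos (K.unfold B.side i o) ∈ Set.Ioo (0 : ℝ) 1)
    (hpj : B.pos (K.unfold B.side j o) ∈ Set.Icc (1 / 4 : ℝ) (3 / 4))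
    (hφ : R * |Real.sin φ| < B.width / 4) (hlen : R + 6 + j < B.length)
    {k : ℕ} (hk : i + k ≤ B.n)
    (hR : B.time (B.pos (K.unfold B.side i o)) (i + k) -
      B.time (B.pos (K.unfold B.side i o)) i ≤ R) :
    j + k ≤ B.n ∧ ∀ l ≤ k, B.side (j + l) = B.side (i + l) := by
  have hw := B.width_pos
  have transport : ∀ l, (∀ m ≤ l, B.side (j + m) = B.side (i + m)) → ∀ (y : ℂ) (ρ : ℝ),
      K.unfold B.side (i + l) y = K.unfold B.side i o + ρ • B.u →
      K.unfold B.side (j + l) y =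
        K.unfold B.side j o + Complex.exp (φ * Complex.I) * ρ • B.u := by
    intro l hl y ρ h
    rw [Kite.unfold_add] at h ⊢
    rw [Kite.unfold_congr (c := fun l => B.side (j + l)) (c' := fun l => B.side (i + l)) hl]
    have := htr (K.unfold (fun l => B.side (i + l)) l y) o
    rw [h, add_sub_cancel_left] at this
    rw [← this]; ring
  -- Starting in the middle half leaves a margin of a quarter of the width on either side, more than
  -- the sideways drift ρ sin φ.
  have posmem : ∀ ρ : ℝ, 0 ≤ ρ → ρ ≤ R →
      B.pos (K.unfold B.side j o + Complex.exp (φ * Complex.I) * ρ • B.u) ∈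
        Set.Ioo (0 : ℝ) 1 := by
    intro ρ h0 h1
    rw [pos_add]
    have h := shift_exp_mul_u (B := B) φ ρ
    have h' : |ρ| * |Real.sin φ| / B.width < 1 / 4 := by
      rw [div_lt_iff₀ hw, abs_of_nonneg h0]
      have := mul_le_mul_of_nonneg_right h1 (abs_nonneg (Real.sin φ))
      linarith
    rw [← h] at h'
    have := abs_lt.1 h'
    constructor <;> linarith [hpj.1, hpj.2]
  have hpj' : B.pos (K.unfold B.side j o) ∈ Set.Ioo (0 : ℝ) 1 :=
    ⟨by linarith [hpj.1], by linarith [hpj.2]⟩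
  have hoj := eq_line_of_mem hj (hside ▸ ho) hpj'
  induction k with
  | zero => exact ⟨hj, fun l hl => by rw [Nat.le_zero.1 hl]; exact hside⟩
  | succ k ih =>
    have hmono := time_mono (B := B) hpi (show i + k ≤ i + (k + 1) by omega) hk
    obtain ⟨ihn, ihs⟩ := ih (by omega) (by linarith)
    obtain ⟨o₁, ho₁, e₁⟩ := exists_mem_openSide_of_line (show i + k ≤ B.n by omega) ho hpi
    obtain ⟨o₂, ho₂, e₂⟩ := exists_mem_openSide_of_line hk ho hpi
    have h0 := time_mono (B := B) hpi (show i ≤ i + k by omega) (by omega)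
    -- The beam does not end here: its lines have length at least `B.length` - 4, whereas this point
    -- is at distance at most j + ρ + 2 from the base. This accounts for the 6 in `hlen`.
    have hlt : j + k < B.n := by
      refine lt_of_le_of_ne ihn fun hn => ?_
      have t₁ := transport k ihs _ _ e₁
      have p₁ := posmem _ (sub_nonneg.2 h0) (by linarith)
      rw [← t₁] at p₁
      have l₁ := eq_line_of_mem ihn (ihs k le_rfl ▸ ho₁) p₁
      set ρ := B.time (B.pos (K.unfold B.side i o)) (i + k) -
        B.time (B.pos (K.unfold B.side i o)) i with hρ
      have hρ0 : 0 ≤ ρ := sub_nonneg.2 h0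
      obtain ⟨t, ht⟩ : ∃ t, t = B.pos (K.unfold B.side (j + k) o₁) := ⟨_, rfl⟩
      obtain ⟨t', ht'⟩ : ∃ t', t' = B.pos (K.unfold B.side j o) := ⟨_, rfl⟩
      rw [← ht] at p₁ l₁
      rw [← ht'] at hpj' hoj
      have e : (B.time t (j + k) - B.time t' j) • B.u =
          Complex.exp (φ * Complex.I) * ρ • B.u - (t - t') • (B.b - B.a) := by
        rw [t₁, hoj] at l₁
        simp only [AffineMap.lineMap_apply, vadd_eq_add, vsub_eq_sub, Complex.real_smul] at l₁ ⊢
        push_cast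
        linear_combination -l₁
      have hn1 : |B.time t (j + k) - B.time t' j| ≤ ρ + 2 := by
        rw [← norm_smul_u (B := B), e]
        refine (norm_sub_le _ _).trans ?_
        rw [norm_mul, Complex.norm_exp_ofReal_mul_I, one_mul, norm_smul_u, abs_of_nonneg hρ0,
          norm_smul, Real.norm_eq_abs]
        have hb := norm_base_le (B := B) hd
        have : |t - t'| ≤ 1 := by
          rw [abs_le]; constructor <;> linarith [p₁.1, p₁.2, hpj'.1, hpj'.2]
        have := mul_le_mul this hb (norm_nonneg _) zero_le_one
        linarith
      have hn2 := length_sub_le_time (B := B) hd p₁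
      rw [← hn] at hn2
      have hn3 := time_le (B := B) hd hpj' hj
      have := le_abs_self (B.time t (j + k) - B.time t' j)
      linarith
    refine ⟨hlt, fun l hl => ?_⟩
    rcases Nat.lt_or_ge l (k + 1) with h | h
    · exact ihs l (by omega)
    · have hl' : l = k + 1 := by omega
      subst hl'
      have e₂' : K.unfold B.side (i + k) o₂ = _ :=
        (Kite.unfold_succ_of_mem_openSide (i := i + k) ho₂).symm.trans e₂
      have t₂ := transport k ihs _ _ e₂'
      have p₂ := posmem _ (sub_nonneg.2 (h0.trans hmono)) hR
      rw [← t₂] at p₂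
      -- The point lies on the entry or the exit side of copy j + k. The entry side has the same
      -- label as in copy i + k, where consecutive sides differ.
      rcases eq_side_of_pos_mem hα hβ hlt ho₂ p₂ with h' | h'
      · exact absurd (h'.trans (ihs k le_rfl)).symm (B.side_ne (i + k) (by omega))
      · exact h'.symm

/-- A fan of parts of a beam that start on the same side at the same point, and overlap each with
the next, cannot spread wider than the kite. -/
theorem false_of_fan (hα : K.angleA < Real.pi) (hβ : K.angleB < Real.pi)
    (hd : Metric.diam K.region = 1) {J L : ℕ} {idx : ℕ → ℕ} {θ : ℕ → ℝ} {d : Fin 4} {o : ℂ}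
    (hside : ∀ m ≤ J, B.side (idx m) = d) (ho : o ∈ K.openSide d)
    (hpos : ∀ m ≤ J, B.pos (K.unfold B.side (idx m) o) ∈ Set.Icc (1 / 4 : ℝ) (3 / 4))
    (hL : ∀ m ≤ J, idx m ≤ L) (hLn : L ≤ B.n)
    (htr : ∀ m ≤ J, ∀ m' ≤ J, ∀ z z', K.unfold B.side (idx m') z - K.unfold B.side (idx m') z' =
      Complex.exp ((θ m' - θ m : ℝ) * Complex.I) *
        (K.unfold B.side (idx m) z - K.unfold B.side (idx m) z'))
    {R : ℝ} (hR : 0 < R) (hstep : ∀ m < J, (R + 2) * |Real.sin (θ (m + 1) - θ m)| < B.width / 4)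
    (hlen : R + 8 + L < B.length) (htotal : 1 < R * |Real.sin (θ J - θ 0)|) : False := by
  have hpos' : ∀ m ≤ J, B.pos (K.unfold B.side (idx m) o) ∈ Set.Ioo (0 : ℝ) 1 := fun m hm =>
    ⟨by linarith [(hpos m hm).1], by linarith [(hpos m hm).2]⟩
  have ho' : ∀ m ≤ J, o ∈ K.openSide (B.side (idx m)) := fun m hm => (hside m hm).symm ▸ ho
  obtain ⟨ρ, hρ⟩ : ∃ ρ : ℕ → ℕ → ℝ, ρ = fun m k =>
      B.time (B.pos (K.unfold B.side (idx m) o)) (idx m + k) -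
        B.time (B.pos (K.unfold B.side (idx m) o)) (idx m) := ⟨_, rfl⟩
  -- The first crossing at distance at least R; since a crossing of one copy takes at most 1, it
  -- overshoots by at most 1.
  obtain ⟨k, hkn, hkR, hkR'⟩ : ∃ k, idx 0 + k ≤ B.n ∧ R ≤ ρ 0 k ∧ ρ 0 k ≤ R + 1 := by
    have h0 := hL 0 (Nat.zero_le _)
    have hex : ∃ k, idx 0 + k ≤ B.n ∧ R ≤ ρ 0 k := by
      refine ⟨B.n - idx 0, by omega, ?_⟩
      have e : idx 0 + (B.n - idx 0) = B.n := by omega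
      have h1 := length_sub_le_time (B := B) hd (hpos' 0 (Nat.zero_le _))
      have h2 := time_le (B := B) hd (hpos' 0 (Nat.zero_le _)) (k := idx 0) (by omega)
      have h3 : (idx 0 : ℝ) ≤ L := by exact_mod_cast h0
      simp only [hρ, e]
      linarith
    classical
    refine ⟨Nat.find hex, (Nat.find_spec hex).1, (Nat.find_spec hex).2, ?_⟩
    have hk0 : Nat.find hex ≠ 0 := by
      intro h
      have := (Nat.find_spec hex).2
      rw [h] at this
      simp only [hρ, add_zero, sub_self] at this
      linarith
    obtain ⟨k', hk'⟩ := Nat.exists_eq_succ_of_ne_zero hk0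
    have hsn := (Nat.find_spec hex).1
    have hmin := Nat.find_min hex (m := k') (by omega)
    rw [hk'] at hsn ⊢
    have hlt : ρ 0 k' < R := by
      by_contra h
      exact hmin ⟨by omega, not_lt.1 h⟩
    have := time_succ_le (B := B) hd (hpos' 0 (Nat.zero_le _)) (k := idx 0 + k') (by omega)
    simp only [hρ] at hlt ⊢
    rw [Nat.succ_eq_add_one, ← add_assoc]
    linarith
  have hit : ∀ m ≤ J, idx m + k ≤ B.n → (∀ l ≤ k, B.side (idx m + l) = B.side (idx 0 + l)) →
      ∃ o' ∈ K.openSide (B.side (idx 0 + k)),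
        K.unfold B.side (idx m) (K.unfold (fun l => B.side (idx 0 + l)) k o') =
          K.unfold B.side (idx m) o + ρ m k • B.u := by
    intro m hm hn hs
    obtain ⟨o', h1, h2⟩ := exists_mem_openSide_of_line hn (ho' m hm) (hpos' m hm)
    refine ⟨o', hs k le_rfl ▸ h1, ?_⟩
    rw [← Kite.unfold_congr (c := fun l => B.side (idx m + l)) hs, ← Kite.unfold_add, h2, hρ]
  obtain ⟨o₀, ho₀, e₀⟩ := hit 0 (Nat.zero_le _) hkn fun _ _ => rfl
  have hdist : ∀ m ≤ J, ∀ o' ρ', K.unfold B.side (idx m) o' = K.unfold B.side (idx m) o +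
      ρ' • B.u → dist o' o = |ρ'| := by
    intro m hm o' ρ' h
    rw [← (K.unfold B.side (idx m)).dist_map, h, dist_eq_norm, add_sub_cancel_left, norm_smul_u]
  have claim : ∀ m ≤ J, idx m + k ≤ B.n ∧ ∀ l ≤ k, B.side (idx m + l) = B.side (idx 0 + l) := by
    intro m
    induction m with
    | zero => exact fun _ => ⟨hkn, fun _ _ => rfl⟩
    | succ m ih =>
      intro hm
      obtain ⟨ih1, ih2⟩ := ih (by omega)
      obtain ⟨o₁, ho₁, e₁⟩ := hit m (by omega) ih1 ih2
      -- Each part is compared with part 0, whose crossing lies on the same side of the same copy,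
      -- rather than with its neighbour; so the error does not accumulate along the fan.
      have hρm : ρ m k ≤ R + 2 := by
        have d1 := hdist m (by omega) _ _ e₁
        have d0 := hdist 0 (by omega) _ _ e₀
        have h1 := Kite.dist_le_of_mem_openSide hd ho₁ ho₀
        rw [← (K.unfold (fun l => B.side (idx 0 + l)) k).dist_map] at h1
        have h2 := dist_triangle (K.unfold (fun l => B.side (idx 0 + l)) k o₁)
          (K.unfold (fun l => B.side (idx 0 + l)) k o₀) o
        rw [abs_of_nonneg (by linarith)] at d0
        linarith [le_abs_self (ρ m k)]
      have hL' : (idx (m + 1) : ℝ) ≤ L := by exact_mod_cast hL (m + 1) hm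
      obtain ⟨h1, h2⟩ := side_eq_side_of_near (i := idx m) (j := idx (m + 1)) (k := k)
        (R := R + 2) hα hβ hd ((hL _ hm).trans hLn)
        ((hside _ hm).trans (hside m (by omega)).symm) (htr m (by omega) (m + 1) hm)
        (ho' m (by omega)) (hpos' m (by omega)) (hpos _ hm) (hstep m (by omega))
        (by linarith) ih1 (by simpa only [hρ] using hρm)
      exact ⟨h1, fun l hl => (h2 l hl).trans (ih2 l hl)⟩
  obtain ⟨hJ1, hJ2⟩ := claim J le_rfl
  obtain ⟨o₁, ho₁, e₁⟩ := hit J le_rfl hJ1 hJ2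
  -- The crossing points of parts 0 and J lie on one side, hence within distance 1, but seen across
  -- part J they are at least R |sin| of the total angle apart.
  have t₀ := htr 0 (Nat.zero_le _) J le_rfl (K.unfold (fun l => B.side (idx 0 + l)) k o₀) o
  rw [e₀, add_sub_cancel_left] at t₀
  have h1 := Kite.dist_le_of_mem_openSide hd ho₀ ho₁
  rw [← (K.unfold (fun l => B.side (idx 0 + l)) k).dist_map,
    ← (K.unfold B.side (idx J)).dist_map, dist_eq_norm] at h1
  have e : K.unfold B.side (idx J) (K.unfold (fun l => B.side (idx 0 + l)) k o₀) -
      K.unfold B.side (idx J) (K.unfold (fun l => B.side (idx 0 + l)) k o₁) =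
      Complex.exp ((θ J - θ 0 : ℝ) * Complex.I) * ρ 0 k • B.u - ρ J k • B.u := by
    rw [e₁, ← t₀]; ring
  have h2 := B.abs_shift_le (K.unfold B.side (idx J) (K.unfold (fun l => B.side (idx 0 + l)) k o₀)
    - K.unfold B.side (idx J) (K.unfold (fun l => B.side (idx 0 + l)) k o₁))
  have h3 : B.shift (-(ρ J k • B.u)) = 0 := by
    rw [← neg_smul, shift_smul, shift_u, mul_zero]
  rw [e, sub_eq_add_neg, shift_add, h3, add_zero, shift_exp_mul_u,
    div_le_div_iff_of_pos_right B.width_pos, ← sub_eq_add_neg, ← e,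
    abs_of_nonneg (by linarith)] at h2
  have := mul_le_mul_of_nonneg_right hkR (abs_nonneg (Real.sin (θ J - θ 0)))
  linarith

end Beam
end KiteBilliard

/-! ### Dense colour classes and integer combinations of the angles. -/

namespace KiteBilliard

/-- Either a colour c is dense at scale η in the interval, or some subinterval of relative length η
avoids c. In the latter case one passes to the subinterval with one colour fewer, at the cost of one
power of η. With no colours left, the mesh g still forces a point, which is absurd. -/
theorem exists_dense_color {ι : Type*} [DecidableEq ι] {X : Set ℝ} {col : ℝ → ι} {η g : ℝ}
    (hη : 0 < η) (hη1 : η ≤ 1) (C : Finset ι) {p l : ℝ} (hl : 0 < l) (hg : g ≤ η ^ C.card * l)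
    (hcol : ∀ x ∈ X, x ∈ Set.Icc p (p + l) → col x ∈ C)
    (hX : ∀ a, p ≤ a → a + g ≤ p + l → ∃ x ∈ X, x ∈ Set.Icc a (a + g)) :
    ∃ c ∈ C, ∃ p' l' : ℝ, 0 < l' ∧ l' ≤ l ∧
      ∀ a, p' ≤ a → a + η * l' ≤ p' + l' → ∃ x ∈ X, col x = c ∧ x ∈ Set.Icc a (a + η * l') := by
  induction C using Finset.induction_on generalizing p l with
  | empty =>
    rw [Finset.card_empty, pow_zero, one_mul] at hg
    obtain ⟨x, hx, h1, h2⟩ := hX p le_rfl (by linarith)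
    exact absurd (hcol x hx ⟨h1, by linarith⟩) (Finset.notMem_empty _)
  | insert c C hc ih =>
    by_cases h : ∀ a, p ≤ a → a + η * l ≤ p + l →
        ∃ x ∈ X, col x = c ∧ x ∈ Set.Icc a (a + η * l)
    · exact ⟨c, Finset.mem_insert_self _ _, p, l, hl, le_rfl, h⟩
    · push Not at h
      obtain ⟨a, ha, hal, hno⟩ := h
      have hηl : η * l ≤ l := mul_le_of_le_one_left hl.le hη1
      rw [Finset.card_insert_of_notMem hc, pow_succ, mul_assoc] at hg
      obtain ⟨c', hc', p', l', h0, h1, h2⟩ := ih (p := a) (l := η * l) (mul_pos hη hl) hg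
        (fun x hx hxI => (Finset.mem_insert.1
          (hcol x hx ⟨ha.trans hxI.1, hxI.2.trans hal⟩)).resolve_left
            fun e => hno x hx e hxI)
        (fun b hb hbl => hX b (ha.trans hb) (hbl.trans hal))
      exact ⟨c', Finset.mem_insert_of_mem hc', p', l', h0, h1.trans hηl, h2⟩

theorem smallN_le {α β : ℝ} {k : ℕ} {n m : ℤ} (h0 : (n, m) ≠ (0, 0))
    (h : |n| + |m| ≤ (k : ℤ)) : smallN α β k ≤ distInt ((n * α + m * β) / (2 * Real.pi)) :=
  csInf_le ⟨0, by rintro d ⟨_, _, _, _, rfl⟩; exact abs_nonneg _⟩ ⟨n, m, h0, h, rfl⟩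

theorem smallN_le_half (α β : ℝ) {k : ℕ} (hk : 0 < k) : smallN α β k ≤ 1 / 2 :=
  (smallN_le (n := 1) (m := 0) (by simp) (by simp; omega)).trans (abs_sub_round _)

/-- The infimum is over a finite set, hence attained; the value 0 would be a rational relation
between α, β and π. -/
theorem smallN_pos {α β : ℝ} (hindep : LinearIndependent ℚ ![α, β, Real.pi]) {k : ℕ}
    (hk : 0 < k) : 0 < smallN α β k := by
  have hne : {d | ∃ n m : ℤ, (n, m) ≠ (0, 0) ∧ |n| + |m| ≤ (k : ℤ) ∧
      d = distInt ((n * α + m * β) / (2 * Real.pi))}.Nonempty :=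
    ⟨_, 1, 0, by simp, by simp; omega, rfl⟩
  have hfin : {d | ∃ n m : ℤ, (n, m) ≠ (0, 0) ∧ |n| + |m| ≤ (k : ℤ) ∧
      d = distInt ((n * α + m * β) / (2 * Real.pi))}.Finite := by
    refine (((Set.finite_Icc (-k : ℤ) k).prod (Set.finite_Icc (-k : ℤ) k)).image
      fun q : ℤ × ℤ => distInt ((q.1 * α + q.2 * β) / (2 * Real.pi))).subset ?_
    rintro d ⟨n, m, -, h, rfl⟩
    refine ⟨(n, m), ⟨⟨?_, ?_⟩, ⟨?_, ?_⟩⟩, rfl⟩ <;> simp only <;>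
      linarith [abs_nonneg n, abs_nonneg m, neg_abs_le n, neg_abs_le m, le_abs_self n,
        le_abs_self m]
  obtain ⟨n, m, h0, -, h⟩ := hne.csInf_mem hfin
  change smallN α β k = _ at h
  rw [h]
  refine abs_pos.2 fun h1 => h0 ?_
  set r := round ((n * α + m * β) / (2 * Real.pi)) with hr
  have h2 : n * α + m * β = r * (2 * Real.pi) :=
    (div_eq_iff (by positivity)).1 (sub_eq_zero.1 h1)
  have h3 := Fintype.linearIndependent_iff.1 hindep ![(n : ℚ), (m : ℚ), -2 * (r : ℚ)] (by
    simp [Fin.sum_univ_three, Rat.smul_def]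
    linarith)
  have hn := h3 0
  have hm := h3 1
  simp at hn hm
  simp [hn, hm]

section turn

open Kite

variable {a : Fin 4 → ℝ} {α β : ℝ}

theorem exists_int_turn_sub
    (ha : ∀ c, a c = α ∨ a c = -α ∨ a c = β ∨ a c = -β) (c : ℕ → Fin 4) {i j : ℕ} (hij : i ≤ j) :
    ∃ n m : ℤ, turn a c j - turn a c i = n * α + m * β ∧ |n| + |m| ≤ (j : ℤ) - i := by
  have key : ∀ (i : ℕ) (d : Fin 4), ∃ n m : ℤ, (-1) ^ i * a d = n * α + m * β ∧
      |n| + |m| ≤ 1 := by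
    intro i d
    rcases neg_one_pow_eq_or ℝ i with h | h <;> rw [h] <;> rcases ha d with e | e | e | e <;>
      rw [e]
    · exact ⟨1, 0, by simp, by simp⟩
    · exact ⟨-1, 0, by simp, by simp⟩
    · exact ⟨0, 1, by simp, by simp⟩
    · exact ⟨0, -1, by simp, by simp⟩
    · exact ⟨-1, 0, by simp, by simp⟩
    · exact ⟨1, 0, by simp, by simp⟩
    · exact ⟨0, -1, by simp, by simp⟩
    · exact ⟨0, 1, by simp, by simp⟩
  induction j, hij using Nat.le_induction with
  | base => exact ⟨0, 0, by simp, by simp⟩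
  | succ j _ ih =>
    obtain ⟨n, m, h, hnm⟩ := ih
    obtain ⟨n', m', h', hnm'⟩ := key j (c (j + 1))
    refine ⟨n + n', m + m', ?_, ?_⟩
    · rw [turn, h']
      push_cast
      linarith
    · have := abs_add_le n n'
      have := abs_add_le m m'
      push_cast
      linarith

theorem exists_int_turn_sub_of_le
    (ha : ∀ c, a c = α ∨ a c = -α ∨ a c = β ∨ a c = -β) (c : ℕ → Fin 4) {i j L : ℕ}
    (hi : i ≤ L) (hj : j ≤ L) :
    ∃ n m : ℤ, turn a c j - turn a c i = n * α + m * β ∧ |n| + |m| ≤ (L : ℤ) := by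
  rcases le_total i j with h | h
  · obtain ⟨n, m, h1, h2⟩ := exists_int_turn_sub ha c h
    exact ⟨n, m, h1, by omega⟩
  · obtain ⟨n, m, h1, h2⟩ := exists_int_turn_sub ha c h
    refine ⟨-n, -m, ?_, ?_⟩
    · push_cast; linarith
    · rw [abs_neg, abs_neg]; omega

theorem isConnectedSeq_turn
    (ha : ∀ c, a c = α ∨ a c = -α ∨ a c = β ∨ a c = -β) (c : ℕ → Fin 4) (n : ℕ) :
    IsConnectedSeq α β n fun i => (turn a c i : Real.Angle) := by
  intro i _
  have h : (turn a c (i + 1) : Real.Angle) - (turn a c i : Real.Angle) =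
      (((-1) ^ i * a (c (i + 1)) : ℝ) : Real.Angle) := by
    rw [← Real.Angle.coe_sub, turn, add_sub_cancel_left]
  simp only [h]
  rcases neg_one_pow_eq_or ℝ i with h | h <;> rw [h] <;>
    rcases ha (c (i + 1)) with e | e | e | e <;> rw [e] <;> simp

theorem exp_eq_one_of_coe_eq {x y : ℝ} (h : (x : Real.Angle) = y) :
    Complex.exp ((y - x : ℝ) * Complex.I) = 1 := by
  obtain ⟨k, hk⟩ := Real.Angle.angle_eq_iff_two_pi_dvd_sub.1 h.symm
  rw [Complex.exp_eq_one_iff]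
  exact ⟨k, by rw [hk]; push_cast; ring⟩

end turn

/-! ### Pigeonhole on the colours of the copies. -/

namespace Beam

open Kite

variable {K : Kite} {B : Beam K}

open Classical in
/-- Either two of the first copies of the kite with the same angle have the same colour, or the
angles of these copies contain a relative net. -/
theorem exists_eq_color_or_net {α β : ℝ} {a : Fin 4 → ℝ}
    (ha : ∀ c, a c = α ∨ a c = -α ∨ a c = β ∨ a c = -β) {δ : ℝ}
    (hδ : (netNumbers α β δ).Nonempty) (c : ℕ → Fin 4)
    {ι : Type*} {C : Finset ι} {N₀ Q : ℕ} (hC : C.card ≤ N₀) (hQ : Q = N₀ * netF α β δ)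
    {col : ℕ → ι} (hcol : ∀ i ≤ Q, col i ∈ C) :
    (∃ i j, i < j ∧ j ≤ Q ∧ col i = col j ∧
      (turn a c i : Real.Angle) = (turn a c j : Real.Angle)) ∨
    ∃ S : Finset Real.Angle, IsRelativeNet δ S ∧
      ∀ x ∈ S, ∃ i ≤ Q, (turn a c i : Real.Angle) = x := by
  by_cases hno : ∃ i j, i < j ∧ j ≤ Q ∧ col i = col j ∧
      (turn a c i : Real.Angle) = (turn a c j : Real.Angle)
  · exact Or.inl hno
  right
  -- Without a repetition each angle is taken by at most N₀ copies. The copies 0 to Q number N₀ F +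
  -- 1, one more than F angles could account for.
  have hcard := Finset.card_le_mul_card_image (f := fun i => (turn a c i : Real.Angle))
    (Finset.range (Q + 1)) N₀ (by
      intro x _
      by_contra! hlt
      obtain ⟨i, hi, j, hj, hne, he⟩ := Finset.exists_ne_map_eq_of_card_lt_of_maps_to
        (hC.trans_lt hlt) (f := col) (by
          intro i hi
          simp only [Finset.coe_filter, Finset.mem_range, Set.mem_ofPred_eq] at hi
          exact hcol i (by omega))
      simp only [Finset.mem_filter, Finset.mem_range] at hi hj
      rcases hne.lt_or_gt with h | h
      · exact hno ⟨i, j, h, by omega, he, hi.2.trans hj.2.symm⟩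
      · exact hno ⟨j, i, h, by omega, he.symm, hj.2.trans hi.2.symm⟩)
  rw [Finset.card_range, hQ] at hcard
  have hlt : netF α β δ <
      ((Finset.range (Q + 1)).image fun i => (turn a c i : Real.Angle)).card := by
    rw [hQ]
    exact Nat.lt_of_mul_lt_mul_left (Nat.lt_of_succ_le hcard)
  obtain ⟨S, hS, hnet⟩ := (Nat.sInf_mem hδ).2 (Q + 1) _ (isConnectedSeq_turn ha c _) hlt
  refine ⟨S, hnet, fun x hx => ?_⟩
  obtain ⟨i, hi, rfl⟩ := Finset.mem_image.1 (hS hx)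
  exact ⟨i, by have := Finset.mem_range.1 hi; omega, rfl⟩

/-- From a relative net of angles of the first copies one extracts a finer relative net all of
whose points have the same colour. -/
theorem exists_monochromatic {a : Fin 4 → ℝ} {c : ℕ → Fin 4} {ι : Type*} [DecidableEq ι]
    {C : Finset ι} {Q : ℕ} {col : ℕ → ι} (hcol : ∀ i ≤ Q, col i ∈ C) {η δ : ℝ} (hη : 0 < η)
    (hη1 : η ≤ 1) (hδ : 0 < δ) (hδη : 2 * δ ≤ η ^ C.card) {S : Finset Real.Angle}
    (hS : IsRelativeNet δ S)
    (hSi : ∀ x ∈ S, ∃ i ≤ Q, (turn a c i : Real.Angle) = x) :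
    ∃ d ∈ C, ∃ p l : ℝ, 0 < l ∧ l < 2 * Real.pi ∧
      ∀ b, p ≤ b → b + η * l ≤ p + l → ∃ x ∈ Set.Icc b (b + η * l), ∃ i ≤ Q, col i = d ∧
        (turn a c i : Real.Angle) = x := by
  classical
  obtain ⟨p, l, hl, hl2, -, hnet⟩ := hS
  set X : Set ℝ := {x | ∃ i ≤ Q, (turn a c i : Real.Angle) = x} with hX
  obtain ⟨idx, hidx⟩ : ∃ idx : ℝ → ℕ, ∀ x ∈ X, idx x ≤ Q ∧ (turn a c (idx x) : Real.Angle) = x :=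
    ⟨fun x => if h : x ∈ X then h.choose else 0, fun x hx => by
      simp only [dif_pos hx]; exact hx.choose_spec⟩
  obtain ⟨d, hd, p', l', h0, h1, h2⟩ := exists_dense_color (X := X) (col := fun x => col (idx x))
    (g := 2 * δ * l) hη hη1 C (p := p) hl (mul_le_mul_of_nonneg_right hδη hl.le)
    (fun x hx _ => hcol _ (hidx x hx).1) (by
      intro b hb hbl
      have e : l * ((b - p) / l) = b - p := mul_div_cancel₀ _ hl.ne'
      have ht0 : 0 ≤ (b - p) / l := div_nonneg (by linarith) hl.le
      have ht1 : (b - p) / l + 2 * δ ≤ 1 := by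
        rw [div_add' _ _ _ hl.ne', div_le_one hl]; linarith
      -- Applying the net property at the midpoint turns distance δ into a point in every interval
      -- of relative length 2δ.
      obtain ⟨s, -, hs, hst⟩ := hnet ((b - p) / l + δ) ⟨by linarith, by linarith⟩
      obtain ⟨i, hi, hx⟩ := hSi _ hs
      have := abs_le.1 hst
      have g1 := mul_le_mul_of_nonneg_left (show (b - p) / l ≤ s by linarith) hl.le
      have g2 := mul_le_mul_of_nonneg_left (show s ≤ (b - p) / l + 2 * δ by linarith) hl.le
      exact ⟨p + l * s, ⟨i, hi, hx⟩, by linarith, by linarith⟩)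
  refine ⟨d, hd, p', l', h0, h1.trans_lt hl2, fun b hb hbl => ?_⟩
  obtain ⟨x, hx, hc, hI⟩ := h2 b hb hbl
  exact ⟨x, hI, idx x, (hidx x hx).1, hc, (hidx x hx).2⟩

end Beam
end KiteBilliard

/-! ### The choice of constants and the conclusion. -/

namespace KiteBilliard
namespace Beam

open Kite ComplexConjugate

variable {K : Kite} {B : Beam K}

/-- The turns of the two copies differ by an integer combination of α and β congruent to y - x
modulo 2π; the combination is nontrivial because y - x lies strictly between 0 and 2π. -/
theorem smallN_le_of_coe_eq {α β : ℝ} {a : Fin 4 → ℝ}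
    (ha : ∀ c, a c = α ∨ a c = -α ∨ a c = β ∨ a c = -β) {c : ℕ → Fin 4} {i j L : ℕ} (hi : i ≤ L)
    (hj : j ≤ L) {x y : ℝ} (hx : (turn a c i : Real.Angle) = x)
    (hy : (turn a c j : Real.Angle) = y) (h0 : x < y) (h1 : y - x < 2 * Real.pi) :
    smallN α β L ≤ (y - x) / (2 * Real.pi) := by
  obtain ⟨n, m, h, hnm⟩ := exists_int_turn_sub_of_le ha c hi hj
  have hang : ((n * α + m * β : ℝ) : Real.Angle) = ((y - x : ℝ) : Real.Angle) := by
    rw [← h, Real.Angle.coe_sub, Real.Angle.coe_sub, hx, hy]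
  obtain ⟨k, hk⟩ := Real.Angle.angle_eq_iff_two_pi_dvd_sub.1 hang
  have hpi := Real.pi_pos
  have hne : (n, m) ≠ (0, 0) := by
    intro he
    obtain ⟨rfl, rfl⟩ := Prod.mk.inj he
    have hk' : y - x = 2 * Real.pi * (-k : ℤ) := by
      push_cast at hk ⊢
      linarith
    rw [hk'] at h1
    have h0' : 0 < 2 * Real.pi * ((-k : ℤ) : ℝ) := hk' ▸ sub_pos.2 h0
    have a1 : (0 : ℝ) < (-k : ℤ) := pos_of_mul_pos_right h0' (by positivity)
    have a2 : ((-k : ℤ) : ℝ) < 1 := by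
      by_contra hc
      nlinarith
    have b1 : (0 : ℤ) < -k := by exact_mod_cast a1
    have b2 : -k < (1 : ℤ) := by exact_mod_cast a2
    omega
  refine (smallN_le hne hnm).trans ?_
  refine (round_le _ k).trans (le_of_eq ?_)
  rw [abs_of_nonneg]
  · field_simp; linarith
  · have : (n * α + m * β) / (2 * Real.pi) - k = (y - x) / (2 * Real.pi) := by
      field_simp; linarith
    rw [this]
    exact div_nonneg (sub_pos.2 h0).le (by positivity)

theorem containsPeriodicTrajectory_of_length {α β : ℝ}
    (hA : K.angleA = α) (hB : K.angleB = β) (hα : α < Real.pi) (hβ : β < Real.pi)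
    (hd : Metric.diam K.region = 1)
    (hindep : LinearIndependent ℚ ![α, β, Real.pi]) (hF : NetFunctionExists α β)
    (hlen : (boundQ α β B.width : ℝ) +
      100 / (B.width * smallN α β (boundQ α β B.width)) < B.length) :
    B.ContainsPeriodicTrajectory := by
  classical
  obtain ⟨ε, hε⟩ : ∃ ε, ε = B.width := ⟨_, rfl⟩
  have hw := B.width_pos
  have hw2 := width_le (B := B) hd
  obtain ⟨D, a, hD, ha, hrot⟩ := K.exists_rotation α β hA hB
  subst hA hB
  have hv := vertex_ne hα hβ
  have htr := fun {i j : ℕ} => unfold_sub_unfold_of_parity hv hD hrot B.side (i := i) (j := j)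
  obtain ⟨N₀, hN₀⟩ : ∃ N₀, N₀ = ⌊16 / ε⌋₊ + 1 := ⟨_, rfl⟩
  obtain ⟨η, hη⟩ : ∃ η, η = ε / 1600 := ⟨_, rfl⟩
  obtain ⟨Q, hQ⟩ : ∃ Q, Q = boundQ K.angleA K.angleB ε := ⟨_, rfl⟩
  rw [← hε] at hlen hw hw2
  rw [← hQ] at hlen
  have hη0 : 0 < η := by rw [hη]; positivity
  have hη1 : η ≤ 1 / 800 := by rw [hη]; linarith
  have hδ0 : 0 < η ^ N₀ := pow_pos hη0 _
  have hδ1 : η ^ N₀ < 1 := pow_lt_one₀ hη0.le (by linarith) (by omega)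
  have hnet := hF (η ^ N₀) ⟨hδ0, hδ1⟩
  have hQ' : Q = N₀ * netF K.angleA K.angleB (η ^ N₀) := by
    rw [hQ, boundQ, boundP, ← hN₀, ← hη]
  have hQ0 : 0 < Q := by
    rw [hQ']
    exact Nat.mul_pos (by omega) (Nat.sInf_mem hnet).1
  obtain ⟨N, hN⟩ : ∃ N, N = smallN K.angleA K.angleB Q := ⟨_, rfl⟩
  have hNpos : 0 < N := hN ▸ smallN_pos hindep hQ0
  have hNhalf : N ≤ 1 / 2 := hN ▸ smallN_le_half _ _ hQ0
  rw [← hN] at hlen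
  have hlen' : (Q : ℝ) + 50 / N < B.length := by
    refine lt_of_le_of_lt (add_le_add_right ?_ _) hlen
    rw [div_le_div_iff₀ hNpos (by positivity)]
    nlinarith
  have hinv : 2 ≤ 1 / N := by rw [le_div_iff₀ hNpos]; linarith
  have h50 : 50 / N = 50 * (1 / N) := by ring
  have hQn : Q ≤ B.n := by
    have ht : (1 / 2 : ℝ) ∈ Set.Ioo (0 : ℝ) 1 := by norm_num
    have h1 := length_sub_le_time (B := B) hd ht
    have h2 := time_le (B := B) hd ht le_rfl
    have : (Q : ℝ) ≤ B.n := by linarith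
    exact_mod_cast this
  obtain ⟨g, hg⟩ : ∃ g : ℕ → ℕ, ∀ k ≤ Q, g k ∈ Finset.Icc 1 ⌊2 / ε⌋₊ ∧
      ∃ o ∈ K.openSide (B.side k),
      o = AffineMap.lineMap (K.vertex (B.side k)) (K.vertex (B.side k + 1)) (g k * (ε / 2)) ∧
      B.pos (K.unfold B.side k o) ∈ Set.Icc (1 / 4 : ℝ) (3 / 4) := by
    have h : ∀ k, ∃ l, k ≤ Q → l ∈ Finset.Icc 1 ⌊2 / ε⌋₊ ∧ ∃ o ∈ K.openSide (B.side k),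
        o = AffineMap.lineMap (K.vertex (B.side k)) (K.vertex (B.side k + 1)) (l * (ε / 2)) ∧
        B.pos (K.unfold B.side k o) ∈ Set.Icc (1 / 4 : ℝ) (3 / 4) := by
      intro k
      by_cases hk : k ≤ Q
      · obtain ⟨l, hl⟩ := exists_grid_point (B := B) hd (hk.trans hQn)
        exact ⟨l, fun _ => by rw [hε]; exact hl⟩
      · exact ⟨0, fun h => absurd h hk⟩
    choose g hg using h
    exact ⟨g, hg⟩
  obtain ⟨col, hcol⟩ : ∃ col : ℕ → Bool × Fin 4 × ℕ,
    col = fun i => (decide (Even i), B.side i, g i) := ⟨_, rfl⟩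
  obtain ⟨C, hC⟩ : ∃ C : Finset (Bool × Fin 4 × ℕ),
    C = Finset.univ ×ˢ Finset.univ ×ˢ Finset.Icc 1 ⌊2 / ε⌋₊ := ⟨_, rfl⟩
  have hcolC : ∀ i ≤ Q, col i ∈ C := by
    intro i hi
    rw [hcol, hC]
    exact Finset.mem_product.2 ⟨Finset.mem_univ _, Finset.mem_product.2
      ⟨Finset.mem_univ _, (hg i hi).1⟩⟩
  -- Two parities, four sides and at most 2/ε grid points. The spare unit gives one more power of η,
  -- which absorbs the factor 2 in the mesh 2δ.
  have hCcard : C.card + 1 ≤ N₀ := by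
    have h : C.card = 8 * ⌊2 / ε⌋₊ := by
      rw [hC, Finset.card_product, Finset.card_product]
      simp
      ring
    rw [h, hN₀]
    refine Nat.succ_le_succ (Nat.le_floor ?_)
    have := Nat.floor_le (a := 2 / ε) (by positivity)
    push_cast
    calc (8 : ℝ) * ⌊2 / ε⌋₊ ≤ 8 * (2 / ε) := by linarith
      _ = 16 / ε := by ring
  have hsame : ∀ i ≤ Q, ∀ j ≤ Q, col i = col j → (Even i ↔ Even j) ∧ B.side i = B.side j ∧
      g i = g j := by
    intro i _ j _ h
    rw [hcol] at h
    simp only [Prod.mk.injEq, decide_eq_decide] at h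
    exact h
  have hpoint : ∀ i ≤ Q, ∀ j ≤ Q, col i = col j → ∀ o,
      o = AffineMap.lineMap (K.vertex (B.side i)) (K.vertex (B.side i + 1)) (g i * (ε / 2)) →
      B.pos (K.unfold B.side j o) ∈ Set.Icc (1 / 4 : ℝ) (3 / 4) := by
    rintro i hi j hj h o rfl
    obtain ⟨-, h2, h3⟩ := hsame i hi j hj h
    obtain ⟨-, o', -, ho', hp⟩ := hg j hj
    rw [h2, h3, ← ho']
    exact hp
  rcases exists_eq_color_or_net ha hnet B.side (C := C) (by omega) hQ' hcolC with
    ⟨i, j, hij, hj, hc, hang⟩ | ⟨S, hS, hSi⟩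
  · obtain ⟨-, o, ho, he, hp⟩ := hg i (by omega)
    have hp' := hpoint i (by omega) j hj hc o he
    obtain ⟨h1, h2, -⟩ := hsame i (by omega) j hj hc
    refine containsPeriodicTrajectory_of_translation hij (hj.trans hQn) h2.symm ho
      ⟨by linarith [hp.1], by linarith [hp.2]⟩ ⟨by linarith [hp'.1], by linarith [hp'.2]⟩ ?_
    intro z z'
    rw [htr h1, exp_eq_one_of_coe_eq hang, one_mul]
  exfalso
  obtain ⟨d, -, p, l, hl, hl2, hdense⟩ := exists_monochromatic hcolC hη0 (by linarith) hδ0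
    (by
      calc 2 * η ^ N₀ ≤ 2 * η ^ (C.card + 1) := by
            have := pow_le_pow_of_le_one hη0.le (by linarith) hCcard
            linarith
        _ = 2 * η * η ^ C.card := by ring
        _ ≤ η ^ C.card := mul_le_of_le_one_left (by positivity) (by linarith)) hS hSi
  -- One angle is taken in each of J + 1 consecutive intervals of length ηl. They span about l/8, so
  -- the total angle stays below π/2.
  obtain ⟨J, hJ⟩ : ∃ J, J = ⌊1 / (8 * η)⌋₊ := ⟨_, rfl⟩
  have hJ1 : J * η ≤ 1 / 8 := by
    have := Nat.floor_le (a := 1 / (8 * η)) (by positivity)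
    rw [← hJ, le_div_iff₀ (by positivity)] at this
    linarith
  have hJ2 : 1 / 8 < (J + 1) * η := by
    have := Nat.lt_floor_add_one (1 / (8 * η))
    rw [← hJ, div_lt_iff₀ (by positivity)] at this
    linarith
  have hJ3 : 2 ≤ J := by
    by_contra hc
    have : (J : ℝ) ≤ 1 := by exact_mod_cast (show J ≤ 1 by omega)
    nlinarith
  have hsel : ∀ m, ∃ x : ℝ, ∃ i, m ≤ J → x ∈ Set.Icc (p + m * (η * l)) (p + (m + 1) * (η * l)) ∧
      i ≤ Q ∧ col i = d ∧ (turn a B.side i : Real.Angle) = x := by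
    intro m
    by_cases hm : m ≤ J
    · have hm' : (m : ℝ) ≤ J := by exact_mod_cast hm
      have h1 : (m : ℝ) * η ≤ J * η := mul_le_mul_of_nonneg_right hm' hη0.le
      have h2 : ((m : ℝ) * η + η) * l ≤ 1 * l := mul_le_mul_of_nonneg_right (by linarith) hl.le
      obtain ⟨x, hx, i, hi, h⟩ := hdense (p + m * (η * l))
        (by linarith [show 0 ≤ m * (η * l) by positivity]) (by linarith)
      exact ⟨x, i, fun _ => ⟨⟨hx.1, by linarith [hx.2]⟩, hi, h⟩⟩
    · exact ⟨0, 0, fun h => absurd h hm⟩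
  choose x idx hidx using hsel
  have hpi := Real.pi_pos
  have hpi3 := Real.pi_gt_three
  have hpi4 := Real.pi_lt_d2
  have hηl : 0 < η * l := mul_pos hη0 hl
  have hsin : ∀ m ≤ J, ∀ m' ≤ J, Real.sin (turn a B.side (idx m') - turn a B.side (idx m)) =
      Real.sin (x m' - x m) := by
    intro m hm m' hm'
    rw [← Real.Angle.sin_coe, ← Real.Angle.sin_coe, Real.Angle.coe_sub, Real.Angle.coe_sub,
      (hidx m hm).2.2.2, (hidx m' hm').2.2.2]
  -- Angles number 0 and 2 are distinct because the interval number 1 separates them; adjacent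
  -- intervals share an endpoint.
  have hNl : N ≤ l / (2 * Real.pi) := by
    obtain ⟨hx0, hi0, -, ht0⟩ := hidx 0 (Nat.zero_le _)
    obtain ⟨hx2, hi2, -, ht2⟩ := hidx 2 hJ3
    have e1 := hx0.1
    have e2 := hx0.2
    have e3 := hx2.1
    have e4 := hx2.2
    push_cast at e1 e2 e3 e4
    have h3 : 3 * (η * l) ≤ l := by nlinarith
    rw [hN]
    refine (smallN_le_of_coe_eq ha hi0 hi2 ht0 ht2 (by linarith) (by linarith)).trans ?_
    exact div_le_div_of_nonneg_right (by linarith) (by positivity)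
  obtain ⟨hx0, hi0, hc0, ht0⟩ := hidx 0 (Nat.zero_le _)
  obtain ⟨-, o, ho, he, -⟩ := hg (idx 0) hi0
  have hRN : 20 / l ≤ 4 * (1 / N) := by
    rw [le_div_iff₀ (by positivity)] at hNl
    rw [mul_one_div, div_le_div_iff₀ hl hNpos]
    nlinarith
  refine false_of_fan (B := B) hα hβ hd (J := J) (L := Q) (idx := idx)
    (θ := fun m => turn a B.side (idx m)) (d := B.side (idx 0)) (o := o) (R := 20 / l)
    (fun m hm => (hsame _ (hidx m hm).2.1 _ hi0 ((hidx m hm).2.2.1.trans hc0.symm)).2.1) ho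
    (fun m hm => hpoint _ hi0 _ (hidx m hm).2.1 (hc0.trans (hidx m hm).2.2.1.symm) o he)
    (fun m hm => (hidx m hm).2.1) hQn
    (fun m hm m' hm' => htr (hsame _ (hidx m hm).2.1 _ (hidx m' hm').2.1
      ((hidx m hm).2.2.1.trans (hidx m' hm').2.2.1.symm)).1)
    (by positivity) ?_ (by linarith) ?_
  · intro m hm
    have e1 := (hidx m hm.le).1.1
    have e2 := (hidx m hm.le).1.2
    have e3 := (hidx (m + 1) hm).1.1
    have e4 := (hidx (m + 1) hm).1.2
    push_cast at e3 e4
    simp only [hsin m hm.le (m + 1) hm]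
    have h1 : |Real.sin (x (m + 1) - x m)| ≤ 2 * (η * l) := by
      refine Real.abs_sin_le_abs.trans ?_
      rw [abs_of_nonneg (by linarith)]
      linarith
    calc (20 / l + 2) * |Real.sin (x (m + 1) - x m)| ≤ (20 / l + 2) * (2 * (η * l)) :=
          mul_le_mul_of_nonneg_left h1 (by positivity)
      _ = (20 + 2 * l) * (2 * η) := by field_simp
      -- Here 33 exceeds 20 + 4π, as l < 2π; the denominator 1600 in η leaves ample room.
      _ < 33 * (2 * η) := mul_lt_mul_of_pos_right (by linarith) (by positivity)
      _ ≤ B.width / 4 := by rw [← hε, hη]; linarith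
  · have e1 := hx0.1
    have e2 := hx0.2
    have e3 := (hidx J le_rfl).1.1
    have e4 := (hidx J le_rfl).1.2
    push_cast at e1 e2
    simp only [hsin 0 (Nat.zero_le _) J le_rfl]
    -- From (J - 1)η > 1/8 - 2η and η ≤ 1/800. Jordan's inequality below then gives the spread 20 ·
    -- (2/π) · 49/400 = 4.9/π > 1.
    have h1 : 49 / 400 * l ≤ x J - x 0 := by
      have : 49 / 400 * l ≤ (J * η - η) * l := mul_le_mul_of_nonneg_right (by linarith) hl.le
      linarith
    have h2 : x J - x 0 ≤ Real.pi / 2 := by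
      have : (J * η + η) * l ≤ 1 / 4 * l := mul_le_mul_of_nonneg_right (by linarith) hl.le
      linarith
    have h3 := Real.mul_le_sin (x := x J - x 0) (le_trans (by positivity) h1) h2
    have h4 : 2 / Real.pi * (49 / 400 * l) ≤ Real.sin (x J - x 0) :=
      (mul_le_mul_of_nonneg_left h1 (by positivity)).trans h3
    have h5 : 20 / l * (2 / Real.pi * (49 / 400 * l)) = 4.9 / Real.pi := by
      field_simp; norm_num
    calc (1 : ℝ) < 4.9 / Real.pi := by rw [lt_div_iff₀ hpi]; linarith
      _ = 20 / l * (2 / Real.pi * (49 / 400 * l)) := h5.symm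
      _ ≤ 20 / l * |Real.sin (x J - x 0)| :=
        mul_le_mul_of_nonneg_left (h4.trans (le_abs_self _)) (by positivity)

end Beam
end KiteBilliard

theorem theorem2 (K : Kite) (α β : ℝ)
    (hA : K.angleA = α) (hB : K.angleB = β) (hα : α < Real.pi) (hβ : β < Real.pi)
    (hdiam : Metric.diam K.region = 1)
    (hindep : LinearIndependent ℚ ![α, β, Real.pi])
    (hF : NetFunctionExists α β) :
    ∃ C : ℝ, 0 < C ∧ ∀ (ε M : ℝ) (B : Beam K), B.width = ε → B.length = M →
      B.ContainsPeriodicTrajectory ∨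
        M ≤ (boundQ α β ε : ℝ) + C / (ε * smallN α β (boundQ α β ε)) := by
  -- Diameter 1 is the only normalization needed, so one constant serves every kite.
  refine ⟨100, by norm_num, ?_⟩
  rintro ε M B rfl rfl
  refine or_iff_not_imp_right.2 fun h => ?_
  exact Beam.containsPeriodicTrajectory_of_length hA hB hα hβ hdiam hindep hF (not_le.1 h)
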